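/- Let $\mathbb F$ be an algebraically closed field of characteristic $0$. For $a,b\in\mathbb F$ write $a>_{\mathbb Z}b$ (resp. $a\ge_{\mathbb Z}b$) if $a-b$ is a positive (resp. nonnegative) integer. Consider functions (sequences) $f$ in $\mathbb F^{\mathbb Z_{>0}}$, $\mathbb F^{\mathbb Z_{<0}}$ or $\mathbb F^{\mathbb Z}$. **Admissible interchanges.** $f$ and $f'$ are connected by the $i$th admissible interchange if $f'$ arises from $f$ by exchanging the values at $i$ and $i+1$ and at least one of the following holds (where conditions involving an index outside the domain are regarded as false): $f(i+1)-f(i)\notin\mathbb Z$; $f(i+1)>_{\mathbb Z}f(i+2)\ge_{\mathbb Z}f(i)$; $f(i)>_{\mathbb Z}f(i+2)\ge_{\mathbb Z}f(i+1)$; $f(i+1)\ge_{\mathbb Z}f(i-1)>_{\mathbb Z}f(i)$; $f(i)\ge_{\mathbb Z}f(i-1)>_{\mathbb Z}f(i+1)$. **Finite RS-algorithm.** For a finite sequence $f_1,\dots,f_n$ in $\mathbb F$ order the pairs $(f_i,i)$ by $(a,i)\prec(b,j)$ iff $a>_{\mathbb Z}b$, or $a=b$ and $i>j$. For each integrality class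 $c\in\mathbb F/\mathbb Z$ apply Robinson–Schensted row insertion with respect to $\prec$, from left to right, to the subsequence of pairs with $f_i\in c$, and replace each pair $(f_i,i)$ in the resulting tableau of inserted pairs by $f_i$. $RS(f_1,\dots,f_n)$ is the collection of these tableaux, indexed by $c$ (the companion tableaux filled with positions are discarded). **Infinite RS-algorithm.** $f$ is *stably decreasing* if $f(i)>_{\mathbb Z}f(i+1)$ for $|i|\gg0$; $f\in\mathbb F^{\mathbb Z}$ is *almost integral* if $f(n_+)-f(n_-)\in\mathbb Z$ for $n_-\ll0$, $n_+\gg0$. - If $f\in\mathbb F^{\mathbb Z_{<0}}$ is stably decreasing, then for $n\gg0$ passing from $RS(f(-n),\dots,f(-1))$ to $RS(f(-n-1),\dots,f(-1))$ only adds the box $f(-n-1)$ at the left end of the first row of one fixed tableau. $RS(f)$ is the resulting limit collection: one tableau with an infinite first row, whose entries are indexed by $\mathbb Z_{<0}$, and with finite lower part, together with finite tableaux for the other integrality classes. - If $f\in\mathbb F^{\mathbb Z_{>0}}$ is stably decreasing, then $RS(f):=RS(f^*)$ where $f^*\in\mathbb F^{\mathbb Z_{<0}}$, $f^*(-i)=-f(i)$.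 - If $f\in\mathbb F^{\mathbb Z}$ is stably decreasing and almost integral, then $RS(f)$ is the analogous limit of $RS(f(m),\dots,f(n))$ for $m\to-\infty$, $n\to+\infty$; here the infinite first row is indexed by $\mathbb Z$, the indexing being fixed so that its $i$th entry is $f(i)$ for $i\ll0$. **Proposition.** Let $f,f'$ both be stably decreasing functions in $\mathbb F^{\mathbb Z_{>0}}$, or both in $\mathbb F^{\mathbb Z_{<0}}$, or both be stably decreasing almost integral functions in $\mathbb F^{\mathbb Z}$. The following conditions are equivalent: a) $f$ and $f'$ are connected by a (finite) series of admissible interchanges; b) $RS(f)=RS(f')$. -/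

import Mathlib

namespace InfRS

section Basic

variable {F : Type*} [Field F]

/-- The relation `a >_ℤ b`: the difference `a - b` is a positive integer. -/
def ZGt (a b : F) : Prop := ∃ n : ℕ, 0 < n ∧ a - b = (n : F)

/-- The relation `a ≥_ℤ b`: the difference `a - b` is a nonnegative integer. -/
def ZGe (a b : F) : Prop := ∃ n : ℕ, a - b = (n : F)

/-- The set `F / ℤ` of integrality classes `a + ℤ`. -/
abbrev IntClass (F : Type*) [Field F] : Type _ := F ⧸ AddSubgroup.zmultiples (1 : F)

/-- The integrality class `a + ℤ` of `a`. -/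
abbrev intClass (a : F) : IntClass F := QuotientAddGroup.mk a

/-! ### Admissible interchanges

Sequences are functions on an index set `ι` of consecutive integers (here `ℤ_{>0}`, `ℤ_{<0}` or
`ℤ`); `i ⋖ j` says that `j` is the index next to `i`. -/

/-- `f` and `g` are connected by the `i`th admissible interchange: they differ by exchanging the
values at `i` and at the next index `j`, and either these values are not integrally related or a
neighbouring value lies between them. -/
def AdmissibleAt {ι : Type*} [Preorder ι] (i : ι) (f g : ι → F) : Prop :=
  ∃ j, i ⋖ j ∧ (∀ k, k ≠ i → k ≠ j → f k = g k) ∧ f i = g j ∧ f j = g i ∧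
    ((¬ ∃ z : ℤ, f j - f i = (z : F)) ∨
     (∃ k, j ⋖ k ∧ ZGt (f j) (f k) ∧ ZGe (f k) (f i)) ∨
     (∃ k, j ⋖ k ∧ ZGt (f i) (f k) ∧ ZGe (f k) (f j)) ∨
     (∃ k, k ⋖ i ∧ ZGe (f j) (f k) ∧ ZGt (f k) (f i)) ∨
     (∃ k, k ⋖ i ∧ ZGe (f i) (f k) ∧ ZGt (f k) (f j)))

/-- `f` and `g` are connected by a (finite) series of admissible interchanges. -/
def Connected {ι : Type*} [Preorder ι] (f g : ι → F) : Prop :=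
  Relation.ReflTransGen (fun p q : ι → F => ∃ i, AdmissibleAt i p q) f g

/-- `f` is stably decreasing: `f(i) >_ℤ f(i+1)` for all but finitely many `i`, that is, for
`|i| ≫ 0`. -/
def StablyDecreasing {ι : Type*} [Preorder ι] (f : ι → F) : Prop :=
  ∀ᶠ i in Filter.cofinite, ∀ j, i ⋖ j → ZGt (f i) (f j)

/-- `f : ℤ → F` is almost integral: `f(n₊) - f(n₋) ∈ ℤ` for `n₋ ≪ 0` and `n₊ ≫ 0`. -/
def AlmostIntegral (f : ℤ → F) : Prop :=
  ∀ᶠ p : ℤ × ℤ in Filter.atBot ×ˢ Filter.atTop, ∃ z : ℤ, f p.2 - f p.1 = (z : F)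

end Basic

/-! ### The Robinson–Schensted algorithm for finite sequences -/

section Insertion

variable {α : Type*}

open Classical in
/-- Insert `x` into a row: `x` replaces the first entry which is larger than `x`, and this entry is
returned; if there is none, `x` is put at the end of the row. -/
noncomputable def rowInsert (lt : α → α → Prop) (x : α) : List α → List α × Option α
  | [] => ([x], none)
  | y :: ys =>
    if lt x y then (x :: ys, some y)
    else (y :: (rowInsert lt x ys).1, (rowInsert lt x ys).2)

/-- Insert `x` into a tableau (a list of rows): an entry bumped from a row is inserted into the next
row. -/
noncomputable def tabInsert (lt : α → α → Prop) : α → List (List α) → List (List α)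
  | x, [] => [[x]]
  | x, r :: rs =>
    match rowInsert lt x r with
    | (r', none) => r' :: rs
    | (r', some y) => r' :: tabInsert lt y rs

/-- The tableau obtained by inserting the entries of a word one after the other, from left to
right. -/
noncomputable def tableau (lt : α → α → Prop) (w : List α) : List (List α) :=
  w.foldl (fun T x => tabInsert lt x T) []

end Insertion

section FiniteRS

variable {F : Type*} [Field F]

/-- The order on pairs `(value, position)`: `(a, i) ≺ (b, j)` iff `a >_ℤ b`, or `a = b` and
`i > j`. -/
def Prec (p q : F × ℕ) : Prop := ZGt p.1 q.1 ∨ (p.1 = q.1 ∧ q.2 < p.2)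

open Classical in
/-- The finite RS-algorithm. To `f₁, …, fₙ` one attaches `(f₁, 1), …, (fₙ, n)`; for every
integrality class `c`, the tableau of the subsequence of those pairs with value in `c` is formed
with respect to `≺`, and every pair is replaced by its value. The output is the collection of these
tableaux, indexed by `c` (empty if `c` contains none of the `fᵢ`). -/
noncomputable def finRS (w : List F) (c : IntClass F) : List (List F) :=
  (tableau Prec ((w.zipIdx 1).filter (fun p => decide (intClass p.1 = c)))).map (List.map Prod.fst)

end FiniteRS

/-! ### The Robinson–Schensted algorithm for infinite sequences -/

section InfiniteRS

variable {F : Type*} [Field F]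

/-- Output of the infinite RS-algorithm: one tableau (in the integrality class `cls`) with an
infinite first row, indexed by `ι`, and finite lower rows; and finite tableaux in the other
classes. -/
@[ext] structure Output (F : Type*) [Field F] (ι : Type*) where
  /-- the integrality class of the infinite tableau -/
  cls : IntClass F
  /-- the first row of the infinite tableau -/
  firstRow : ι → F
  /-- at `cls`, the infinite tableau without its first row; at every other class, the finite
  tableau of that class (possibly empty) -/
  rest : IntClass F → List (List F)

open Classical in
/-- The collection of finite tableaux obtained by replacing the infinite first row by the finite
row `row`. -/
noncomputable def Output.withRow {ι : Type*} (T : Output F ι) (row : List F) :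
    IntClass F → List (List F) :=
  fun c => if c = T.cls then row :: T.rest c else T.rest c

/-- The finite tail `f(-n), …, f(-1)`. -/
def tail (f : Set.Iio (0 : ℤ) → F) (n : ℕ) : List F :=
  List.ofFn fun k : Fin n => f ⟨(k : ℤ) - n, by have := k.2; simp only [Set.mem_Iio]; omega⟩

/-- The finite subsequence `f(m), …, f(n)`. -/
def window (f : ℤ → F) (m n : ℤ) : List F :=
  (List.range (n + 1 - m).toNat).map fun k : ℕ => f (m + k)

/-- `T` is the output of the infinite RS-algorithm for `f : ℤ_{<0} → F`: for all large tails of `f`,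
the output of the finite RS-algorithm is `T` with its first row cut down to a finite tail. Here `r`
is the number of entries which are not in the first row of the infinite tableau. The first row is
numbered such that its last entry has index `-1`. -/
def IsOutputLeft (f : Set.Iio (0 : ℤ) → F) (T : Output F (Set.Iio (0 : ℤ))) : Prop :=
  ∃ r : ℕ, ∀ᶠ n : ℕ in Filter.atTop, finRS (tail f (n + r)) = T.withRow (tail T.firstRow n)

/-- `T` is the output of the infinite RS-algorithm for `f : ℤ → F`: for all `m ≪ 0` and `n ≫ 0`, the
output of the finite RS-algorithm for a middle subsequence of `f` is `T` with its first row cut down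
to the positions `m, …, n`. The first row is numbered such that its `i`th entry is `f(i)` for
`i ≪ 0`. -/
def IsOutputTwo (f : ℤ → F) (T : Output F ℤ) : Prop :=
  (∀ᶠ i : ℤ in Filter.atBot, T.firstRow i = f i) ∧
  ∃ r : ℕ, ∀ᶠ p : ℤ × ℤ in Filter.atBot ×ˢ Filter.atTop,
    finRS (window f p.1 (p.2 + r)) = T.withRow (window T.firstRow p.1 p.2)

/-- The sequence `f* = (…, -f(3), -f(2), -f(1))`. -/
def dual (f : Set.Ioi (0 : ℤ) → F) : Set.Iio (0 : ℤ) → F :=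
  fun i => - f ⟨-i.1, by have := i.2; simp only [Set.mem_Iio, Set.mem_Ioi] at *; omega⟩

end InfiniteRS

/-! ### The infinite algorithm is well defined -/

section InsertionLemmas

variable {α β : Type*} {lt : α → α → Prop}

theorem tabInsert_cons_first {x y : α} (h : ¬ lt y x) (T : List (List α)) :
    tabInsert lt y ((x :: T.headD []) :: T.tail) =
      (x :: (tabInsert lt y T).headD []) :: (tabInsert lt y T).tail := by
  cases T with
  | nil => simp [tabInsert, rowInsert, h]
  | cons r rs =>
    simp only [List.headD_cons, List.tail_cons, tabInsert, rowInsert, h, if_false]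
    rcases rowInsert lt y r with ⟨r', _ | z⟩ <;> simp

theorem tableau_cons {x : α} (w : List α) (h : ∀ y ∈ w, ¬ lt y x) :
    tableau lt (x :: w) = (x :: (tableau lt w).headD []) :: (tableau lt w).tail := by
  induction w using List.reverseRecOn with
  | nil => simp [tableau, tabInsert]
  | append_singleton w y ih =>
    have ih' := ih (fun z hz => h z (by simp [hz]))
    have e1 : tableau lt (x :: (w ++ [y])) = tabInsert lt y (tableau lt (x :: w)) := by
      simp [tableau]
    have e2 : tableau lt (w ++ [y]) = tabInsert lt y (tableau lt w) := by simp [tableau]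
    rw [e1, e2, ih', tabInsert_cons_first (h y (by simp))]

theorem rowInsert_last {y : α} (r : List α) (h : ∀ z ∈ r, ¬ lt y z) :
    rowInsert lt y r = (r ++ [y], none) := by
  induction r with
  | nil => simp [rowInsert]
  | cons a r ih =>
    have := ih (fun z hz => h z (by simp [hz]))
    simp [rowInsert, h a (by simp), this]

theorem tabInsert_last {y : α} (T : List (List α)) (h : ∀ z ∈ T.headD [], ¬ lt y z) :
    tabInsert lt y T = (T.headD [] ++ [y]) :: T.tail := by
  cases T with
  | nil => simp [tabInsert]
  | cons r rs =>
    simp only [List.headD_cons] at h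
    simp [tabInsert, rowInsert_last r h]

theorem rowInsert_mem {x y : α} (r : List α) (h : y ∈ (rowInsert lt x r).1) : y = x ∨ y ∈ r := by
  induction r with
  | nil => simpa [rowInsert] using h
  | cons a r ih =>
    simp only [rowInsert] at h
    split_ifs at h <;> simp only [List.mem_cons] at h ⊢ <;> tauto

theorem rowInsert_length (x : α) (r : List α) : (rowInsert lt x r).1.length ≤ r.length + 1 := by
  induction r with
  | nil => simp [rowInsert]
  | cons a r ih =>
    simp only [rowInsert]
    split_ifs <;> simp [ih]

theorem head_tabInsert (x : α) (T : List (List α)) :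
    (tabInsert lt x T).headD [] = (rowInsert lt x (T.headD [])).1 := by
  cases T with
  | nil => simp [tabInsert, rowInsert]
  | cons r rs =>
    simp only [tabInsert, List.headD_cons]
    rcases rowInsert lt x r with ⟨r', _ | z⟩ <;> simp

theorem tableau_append_singleton (w : List α) (y : α) :
    tableau lt (w ++ [y]) = tabInsert lt y (tableau lt w) := by simp [tableau]

theorem head_tableau_mem (w : List α) {y : α} (h : y ∈ (tableau lt w).headD []) : y ∈ w := by
  induction w using List.reverseRecOn with
  | nil => simp [tableau] at h
  | append_singleton w x ih =>
    rw [tableau_append_singleton, head_tabInsert] at h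
    rcases rowInsert_mem _ h with h | h
    · simp [h]
    · simp [ih h]

theorem head_tableau_length (w : List α) : ((tableau lt w).headD []).length ≤ w.length := by
  induction w using List.reverseRecOn with
  | nil => simp [tableau]
  | append_singleton w x ih =>
    rw [tableau_append_singleton, head_tabInsert]
    refine (rowInsert_length _ _).trans ?_
    simpa using ih

theorem tableau_append_left (A w : List α) (hA : A.Pairwise fun a b => ¬ lt b a)
    (hAw : ∀ a ∈ A, ∀ y ∈ w, ¬ lt y a) :
    (tableau lt (A ++ w)).headD [] = A ++ (tableau lt w).headD [] ∧
      (tableau lt (A ++ w)).tail = (tableau lt w).tail := by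
  induction A with
  | nil => simp
  | cons a A ih =>
    rw [List.pairwise_cons] at hA
    have ih' := ih hA.2 (fun b hb => hAw b (by simp [hb]))
    have : tableau lt (a :: (A ++ w)) = _ := tableau_cons (A ++ w) (by
      intro y hy
      rcases List.mem_append.1 hy with hy | hy
      · exact hA.1 y hy
      · exact hAw a (by simp) y hy)
    rw [List.cons_append, this, List.headD_cons, List.tail_cons, ih'.1, ih'.2]
    exact ⟨rfl, rfl⟩

theorem tableau_append_right (w B : List α) (hB : B.Pairwise fun a b => ¬ lt b a)
    (hwB : ∀ y ∈ w, ∀ b ∈ B, ¬ lt b y) :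
    (tableau lt (w ++ B)).headD [] = (tableau lt w).headD [] ++ B ∧
      (tableau lt (w ++ B)).tail = (tableau lt w).tail := by
  induction B using List.reverseRecOn with
  | nil => simp
  | append_singleton B b ih =>
    rw [List.pairwise_append] at hB
    have ih' := ih hB.1 (fun y hy c hc => hwB y hy c (by simp [hc]))
    rw [← List.append_assoc, tableau_append_singleton, tabInsert_last]
    · rw [List.headD_cons, List.tail_cons, ih'.1, ih'.2, List.append_assoc]
      exact ⟨rfl, rfl⟩
    · intro z hz
      rcases List.mem_append.1 (head_tableau_mem _ hz) with h | h
      · exact hwB z h b (by simp)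
      · exact hB.2.2 z h b (by simp)

theorem rowInsert_map {lt' : β → β → Prop} (g : α → β) (h : ∀ a b, lt' (g a) (g b) ↔ lt a b)
    (x : α) (r : List α) :
    rowInsert lt' (g x) (r.map g) =
      ((rowInsert lt x r).1.map g, (rowInsert lt x r).2.map g) := by
  induction r with
  | nil => simp [rowInsert]
  | cons a r ih =>
    by_cases hx : lt x a
    · simp [rowInsert, (h x a).2 hx, hx]
    · simp [rowInsert, mt (h x a).1 hx, hx, ih]

theorem tabInsert_map {lt' : β → β → Prop} (g : α → β) (h : ∀ a b, lt' (g a) (g b) ↔ lt a b)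
    (x : α) (T : List (List α)) :
    tabInsert lt' (g x) (T.map (List.map g)) = (tabInsert lt x T).map (List.map g) := by
  induction T generalizing x with
  | nil => simp [tabInsert]
  | cons r rs ih =>
    simp only [tabInsert, List.map_cons, rowInsert_map g h]
    rcases rowInsert lt x r with ⟨r', _ | z⟩
    · simp
    · simp [ih]

theorem tableau_map {lt' : β → β → Prop} (g : α → β) (h : ∀ a b, lt' (g a) (g b) ↔ lt a b)
    (w : List α) : tableau lt' (w.map g) = (tableau lt w).map (List.map g) := by
  induction w using List.reverseRecOn with
  | nil => simp [tableau]
  | append_singleton w x ih =>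
    rw [List.map_append, List.map_singleton, tableau_append_singleton, tableau_append_singleton,
      ih, tabInsert_map g h]

end InsertionLemmas

section WellDefined

set_option linter.unusedSectionVars false

variable {F : Type*} [Field F]

theorem ZGt.trans {a b c : F} (h : ZGt a b) (h' : ZGt b c) : ZGt a c := by
  obtain ⟨m, hm, e⟩ := h
  obtain ⟨n, hn, e'⟩ := h'
  exact ⟨m + n, by omega, by push_cast; linear_combination e + e'⟩

theorem ZGt.intClass_eq {a b : F} (h : ZGt a b) : intClass a = intClass b := by
  obtain ⟨m, hm, e⟩ := h
  refine (QuotientAddGroup.eq.2 ?_).symm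
  exact ⟨m, by simp [← e]; ring⟩

theorem intClass_eq_iff {a b : F} : intClass a = intClass b ↔ ∃ z : ℤ, b - a = (z : F) := by
  rw [QuotientAddGroup.eq, AddSubgroup.mem_zmultiples_iff]
  refine exists_congr fun z => ?_
  rw [zsmul_one, neg_add_eq_sub, eq_comm]

theorem not_prec [CharZero F] {p q : F × ℕ} (h : ZGt p.1 q.1) : ¬ Prec q p := by
  obtain ⟨m, hm, e⟩ := h
  rintro (⟨n, hn, e'⟩ | ⟨e', -⟩)
  · have : ((m + n : ℕ) : F) = 0 := by push_cast; linear_combination -e - e'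
    rw [Nat.cast_eq_zero] at this
    omega
  · have : ((m : ℕ) : F) = 0 := by rw [← e, e', sub_self]
    rw [Nat.cast_eq_zero] at this
    omega

/-- The subword of the pairs with value in `c`, with positions counted from `k`. -/
noncomputable abbrev part (w : List F) (k : ℕ) (c : IntClass F) : List (F × ℕ) :=
  open Classical in (w.zipIdx k).filter (fun p => decide (intClass p.1 = c))

theorem mem_part {w : List F} {k : ℕ} {c : IntClass F} {p : F × ℕ} (h : p ∈ part w k c) :
    p.1 ∈ w ∧ intClass p.1 = c := by
  rw [List.mem_filter, decide_eq_true_iff] at h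
  exact ⟨List.fst_mem_of_mem_zipIdx h.1, h.2⟩

theorem finRS_shift (w : List F) (k : ℕ) (c : IntClass F) :
    (tableau Prec (part w k c)).map (List.map Prod.fst) = finRS w c := by
  have key : ∀ k, (tableau Prec (part w k c)).map (List.map Prod.fst) =
      (tableau Prec (part w 0 c)).map (List.map Prod.fst) := by
    intro k
    have e : w.zipIdx k = (w.zipIdx 0).map (fun p => (p.1, p.2 + k)) := by
      rw [List.zipIdx_eq_map_add]
      simp [Nat.add_comm]
    have e2 : part w k c = (part w 0 c).map (fun p => (p.1, p.2 + k)) := by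
      unfold part
      rw [e, List.filter_map]
      rfl
    rw [e2, tableau_map (lt := Prec) (fun p : F × ℕ => (p.1, p.2 + k))
      (fun a b => by simp [Prec]), List.map_map]
    congr 1
    funext l
    simp
  rw [key k, ← key 1]
  rfl

theorem part_append (v w : List F) (k : ℕ) (c : IntClass F) :
    part (v ++ w) k c = part v k c ++ part w (k + v.length) c := by
  simp [part, List.zipIdx_append]

theorem part_eq_nil {w : List F} {k : ℕ} {c : IntClass F} (h : ∀ a ∈ w, intClass a ≠ c) :
    part w k c = [] := by
  refine List.eq_nil_iff_forall_not_mem.2 fun p hp => ?_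
  exact h _ (mem_part hp).1 (mem_part hp).2

theorem map_fst_part {w : List F} {k : ℕ} {c : IntClass F} (h : ∀ a ∈ w, intClass a = c) :
    (part w k c).map Prod.fst = w := by
  have : part w k c = w.zipIdx k := by
    refine List.filter_eq_self.2 fun p hp => ?_
    simpa using h _ (List.fst_mem_of_mem_zipIdx hp)
  rw [this, List.zipIdx_map_fst]

theorem pairwise_part [CharZero F] {w : List F} (k : ℕ) (c : IntClass F) (h : w.Pairwise ZGt) :
    (part w k c).Pairwise fun a b => ¬ Prec b a := by
  refine List.Pairwise.sublist List.filter_sublist ?_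
  have : ((w.zipIdx k).map Prod.fst).Pairwise ZGt := by rwa [List.zipIdx_map_fst]
  exact (List.pairwise_map.1 this).imp fun h => not_prec h

theorem headD_map {α β : Type*} (g : α → β) (T : List (List α)) :
    (T.map (List.map g)).headD [] = (T.headD []).map g := by
  cases T <;> simp

theorem finRS_sandwich [CharZero F] {A C B : List F} {d : IntClass F} (hne : A ≠ [])
    (hA : ∀ a ∈ A, intClass a = d) (hB : ∀ b ∈ B, intClass b = d)
    (hAA : A.Pairwise ZGt) (hBB : B.Pairwise ZGt)
    (hAC : ∀ a ∈ A, ∀ y ∈ C, intClass y = d → ZGt a y)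
    (hAB : ∀ a ∈ A, ∀ b ∈ B, ZGt a b)
    (hCB : ∀ y ∈ C, intClass y = d → ∀ b ∈ B, ZGt y b) (c : IntClass F) :
    (c = d → finRS (A ++ (C ++ B)) c = (A ++ (finRS C c).headD [] ++ B) :: (finRS C c).tail) ∧
    (c ≠ d → finRS (A ++ (C ++ B)) c = finRS C c) := by
  constructor
  · rintro rfl
    have e : finRS (A ++ (C ++ B)) c = (tableau Prec (part A 1 c ++ (part C (1 + A.length) c ++
        part B (1 + A.length + C.length) c))).map (List.map Prod.fst) := by
      rw [← part_append, ← part_append, finRS_shift]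
    have h1 := tableau_append_left (lt := Prec) (part A 1 c)
      (part C (1 + A.length) c ++ part B (1 + A.length + C.length) c) (pairwise_part _ _ hAA) (by
        intro a ha y hy
        rcases List.mem_append.1 hy with hy | hy
        · exact not_prec (hAC _ (mem_part ha).1 _ (mem_part hy).1 (mem_part hy).2)
        · exact not_prec (hAB _ (mem_part ha).1 _ (mem_part hy).1))
    have h2 := tableau_append_right (lt := Prec) (part C (1 + A.length) c)
      (part B (1 + A.length + C.length) c) (pairwise_part _ _ hBB) (by
        intro y hy b hb
        exact not_prec (hCB _ (mem_part hy).1 (mem_part hy).2 _ (mem_part hb).1))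
    rw [h2.1, h2.2] at h1
    have hC := finRS_shift C (1 + A.length) c
    have hh : (finRS (A ++ (C ++ B)) c).headD [] = A ++ (finRS C c).headD [] ++ B := by
      rw [e, headD_map, h1.1, List.map_append, List.map_append, map_fst_part hA, map_fst_part hB,
        ← hC, headD_map, List.append_assoc]
    have ht : (finRS (A ++ (C ++ B)) c).tail = (finRS C c).tail := by
      rw [e, ← List.map_tail, h1.2, List.map_tail, hC]
    rw [← hh, ← ht]
    cases h : finRS (A ++ (C ++ B)) c with
    | nil => rw [h] at hh; simp [hne] at hh
    | cons r rs => simp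
  · intro hc
    rw [← finRS_shift _ 1, part_append, part_append, part_eq_nil (fun a ha => hA a ha ▸ hc.symm),
      part_eq_nil (w := B) (fun a ha => hB a ha ▸ hc.symm), List.nil_append, List.append_nil,
      finRS_shift]

theorem head_finRS_length (w : List F) (c : IntClass F) :
    ((finRS w c).headD []).length ≤ w.length := by
  rw [← finRS_shift w 1 c, headD_map, List.length_map]
  refine (head_tableau_length _).trans ?_
  exact (List.length_filter_le _ _).trans (by simp)

/-! Windows. -/

theorem window_length (f : ℤ → F) (m n : ℤ) : (window f m n).length = (n + 1 - m).toNat := by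
  simp [window]

theorem window_getElem (f : ℤ → F) (m n : ℤ) (k : ℕ) (h : k < (window f m n).length) :
    (window f m n)[k] = f (m + k) := by
  simp [window]

theorem mem_window {f : ℤ → F} {m n : ℤ} {a : F} :
    a ∈ window f m n ↔ ∃ i, m ≤ i ∧ i ≤ n ∧ f i = a := by
  simp only [window, List.mem_map, List.mem_range]
  constructor
  · rintro ⟨k, hk, rfl⟩
    exact ⟨m + k, by omega, by omega, rfl⟩
  · rintro ⟨i, h1, h2, rfl⟩
    exact ⟨(i - m).toNat, by omega, by congr 1; omega⟩

theorem window_append (f : ℤ → F) {m k n : ℤ} (h1 : m ≤ k) (h2 : k ≤ n + 1) :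
    window f m n = window f m (k - 1) ++ window f k n := by
  refine List.ext_getElem ?_ ?_
  · simp only [List.length_append, window_length]; omega
  · intro i hi hi'
    rw [List.getElem_append, window_getElem]
    split_ifs with h
    · rw [window_getElem]
    · rw [window_getElem, window_length]
      rw [window_length] at h
      congr 1; omega

theorem window_congr {f g : ℤ → F} {m n : ℤ} (h : ∀ i, m ≤ i → i ≤ n → f i = g i) :
    window f m n = window g m n := by
  refine List.ext_getElem (by simp [window_length]) fun i hi hi' => ?_
  rw [window_getElem, window_getElem]
  rw [window_length] at hi
  exact h _ (by omega) (by omega)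

theorem window_shift (f : ℤ → F) (m n r : ℤ) :
    window (fun i => f (i + r)) m n = window f (m + r) (n + r) := by
  refine List.ext_getElem (by simp only [window_length]; omega) fun i hi hi' => ?_
  rw [window_getElem, window_getElem]
  congr 1; omega

theorem window_pairwise {f : ℤ → F} {m n : ℤ}
    (h : ∀ i j, m ≤ i → i < j → j ≤ n → ZGt (f i) (f j)) : (window f m n).Pairwise ZGt := by
  rw [window, List.pairwise_map]
  refine List.pairwise_lt_range.imp_of_mem fun {a b} ha hb hab => ?_
  rw [List.mem_range] at ha hb
  exact h _ _ (by omega) (by omega) (by omega)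

/-- The first row of the output, built from a finite row `R` placed at the positions from `m₁` on.
The entries to the right of `R` are shifted by `r`. -/
noncomputable def glue (f : ℤ → F) (m₁ r : ℤ) (R : List F) (i : ℤ) : F :=
  if i < m₁ then f i else if h : (i - m₁).toNat < R.length then R[(i - m₁).toNat] else f (i + r)

theorem window_glue (f : ℤ → F) {m m₁ n r : ℤ} (R : List F) (hm : m ≤ m₁)
    (hn : m₁ + R.length ≤ n + 1) :
    window (glue f m₁ r R) m n =
      window f m (m₁ - 1) ++ R ++ window f (m₁ + R.length + r) (n + r) := by
  rw [window_append (k := m₁ + R.length) _ (by omega) hn, window_append (k := m₁) _ hm (by omega),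
    ← window_shift]
  congr 1
  · congr 1
    · refine window_congr fun i h1 h2 => ?_
      rw [glue, if_pos (by omega)]
    · refine List.ext_getElem (by rw [window_length]; omega) fun i hi hi' => ?_
      rw [window_getElem, glue, if_neg (by omega), dif_pos (by omega)]
      congr 1; omega
  · refine window_congr fun i h1 h2 => ?_
    rw [glue, if_neg (by omega), dif_neg (by omega)]

/-! Decreasing tails. -/

theorem chain_left {f : ℤ → F} {N : ℤ} (h : ∀ i < N, ZGt (f i) (f (i + 1))) (k : ℕ) :
    ∀ i, i + k + 1 ≤ N → ∃ n : ℕ, k < n ∧ f i - f (i + k + 1) = n := by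
  induction k with
  | zero =>
    intro i hi
    obtain ⟨n, hn, e⟩ := h i (by omega)
    exact ⟨n, hn, by simpa using e⟩
  | succ k ih =>
    intro i hi
    obtain ⟨n, hn, e⟩ := h i (by omega)
    obtain ⟨n', hn', e'⟩ := ih (i + 1) (by push_cast at hi; omega)
    refine ⟨n + n', by omega, ?_⟩
    have : i + 1 + (k : ℤ) + 1 = i + ((k + 1 : ℕ) : ℤ) + 1 := by push_cast; ring
    rw [← this]
    push_cast
    linear_combination e + e'

theorem chain_left' {f : ℤ → F} {N : ℤ} (h : ∀ i < N, ZGt (f i) (f (i + 1))) {i j : ℤ}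
    (hij : i < j) (hj : j ≤ N) : ∃ n : ℕ, j - i ≤ n ∧ 0 < n ∧ f i - f j = n := by
  obtain ⟨n, hn, e⟩ := chain_left h (j - i - 1).toNat i (by omega)
  refine ⟨n, by omega, by omega, ?_⟩
  rw [← e]
  congr 2
  omega

theorem chain_gt {f : ℤ → F} {N : ℤ} (h : ∀ i < N, ZGt (f i) (f (i + 1))) {i j : ℤ}
    (hij : i < j) (hj : j ≤ N) : ZGt (f i) (f j) := by
  obtain ⟨n, -, h0, e⟩ := chain_left' h hij hj
  exact ⟨n, h0, e⟩

/-- Far to the left, the values exceed all later integrally related values, up to a bound `M`. -/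
theorem far_left {f : ℤ → F} {N : ℤ} (h : ∀ i < N, ZGt (f i) (f (i + 1))) (M : ℤ) :
    ∃ m₀ < N, ∀ m ≤ m₀, ∀ i, m < i → i ≤ M → intClass (f i) = intClass (f N) →
      ZGt (f m) (f i) := by
  have key : ∀ i : ℤ, ∀ᶠ m in Filter.atBot,
      intClass (f i) = intClass (f N) → ZGt (f m) (f i) := by
    intro i
    by_cases hc : intClass (f i) = intClass (f N)
    · obtain ⟨z, hz⟩ := intClass_eq_iff.1 hc
      filter_upwards [Filter.eventually_lt_atBot N, Filter.eventually_lt_atBot (N + z)]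
        with m h1 h2 _
      obtain ⟨n, hn, -, e⟩ := chain_left' h h1 le_rfl
      refine ⟨(n + z).toNat, by omega, ?_⟩
      have : (((n + z).toNat : ℤ) : F) = ((n + z : ℤ) : F) := by congr 1; omega
      rw [← Int.cast_natCast, this]
      push_cast
      linear_combination e + hz
    · exact Filter.Eventually.of_forall fun m h => absurd h hc
  have : ∀ᶠ m in Filter.atBot, ∀ i ∈ Set.Icc N M,
      intClass (f i) = intClass (f N) → ZGt (f m) (f i) :=
    (Filter.eventually_all_finite (Set.finite_Icc N M)).2 fun i _ => key i
  obtain ⟨m₀, hm₀⟩ := Filter.eventually_atBot.1 (this.and (Filter.eventually_lt_atBot N))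
  refine ⟨m₀, (hm₀ m₀ le_rfl).2, fun m hm i hmi hiM hc => ?_⟩
  rcases lt_or_ge i N with hi | hi
  · exact chain_gt h hmi hi.le
  · exact (hm₀ m hm).1 i ⟨hi, hiM⟩ hc

theorem chain_class {f : ℤ → F} {N : ℤ} (h : ∀ i < N, ZGt (f i) (f (i + 1))) {i : ℤ}
    (hi : i ≤ N) : intClass (f i) = intClass (f N) := by
  rcases hi.lt_or_eq with hi | rfl
  · exact (chain_gt h hi le_rfl).intClass_eq
  · rfl

theorem ZGt.neg {a b : F} (h : ZGt a b) : ZGt (-b) (-a) := by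
  obtain ⟨n, hn, e⟩ := h
  exact ⟨n, hn, by linear_combination e⟩

theorem intClass_neg {a b : F} (h : intClass a = intClass b) : intClass (-a) = intClass (-b) := by
  obtain ⟨z, hz⟩ := intClass_eq_iff.1 h
  exact intClass_eq_iff.2 ⟨-z, by push_cast; linear_combination -hz⟩

/-- The mirror image of `far_left`. -/
theorem far_right {f : ℤ → F} {N : ℤ} (h : ∀ i ≥ N, ZGt (f i) (f (i + 1))) (M : ℤ) :
    (∀ i ≥ N, intClass (f i) = intClass (f N)) ∧ (∀ i j, N ≤ i → i < j → ZGt (f i) (f j)) ∧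
    ∃ n₀ > N, ∀ n ≥ n₀, ∀ i, i < n → M ≤ i → intClass (f i) = intClass (f N) →
      ZGt (f i) (f n) := by
  have hg : ∀ i < -N, ZGt (-f (-i)) (-f (-(i + 1))) := by
    intro i hi
    have := (h (-i - 1) (by omega)).neg
    rwa [show -i - 1 + 1 = -i by ring, show -i - 1 = -(i + 1) by ring] at this
  refine ⟨fun i hi => ?_, fun i j hi hij => ?_, ?_⟩
  · have := chain_class (f := fun i => -f (-i)) hg (i := -i) (by omega)
    simpa using intClass_neg this
  · have := (chain_gt (f := fun i => -f (-i)) hg (i := -j) (j := -i) (by omega) (by omega)).neg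
    simpa using this
  · obtain ⟨m₀, hm₀, H⟩ := far_left (f := fun i => -f (-i)) hg (-M)
    refine ⟨-m₀, by omega, fun n hn i hin hiM hc => ?_⟩
    have := (H (-n) (by omega) (-i) (by omega) (by omega)
      (by simpa using intClass_neg hc)).neg
    simpa using this

theorem tail_restrict (g : ℤ → F) (n : ℕ) :
    tail (fun i : Set.Iio (0 : ℤ) => g i.1) n = window g (-n) (-1) := by
  refine List.ext_getElem (by simp [tail, window_length]) fun i hi hi' => ?_
  rw [window_getElem]
  simp only [tail, List.getElem_ofFn]
  congr 1
  omega

theorem tail_length (f : Set.Iio (0 : ℤ) → F) (n : ℕ) : (tail f n).length = n := by simp [tail]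

theorem exists_output_left [CharZero F] {f : Set.Iio (0 : ℤ) → F} (hf : StablyDecreasing f) :
    ∃ T, IsOutputLeft f T := by
  classical
  obtain ⟨g, rfl⟩ : ∃ g : ℤ → F, f = fun i : Set.Iio (0 : ℤ) => g i.1 :=
    ⟨fun i => if h : i < 0 then f ⟨i, h⟩ else 0, by
      funext i; have hi : i.1 < 0 := i.2; simp [hi]⟩
  obtain ⟨N, hN0, hN⟩ : ∃ N < 0, ∀ i < N, ZGt (g i) (g (i + 1)) := by
    have hfin : (Subtype.val '' {i : Set.Iio (0 : ℤ) | ¬ ∀ j, i ⋖ j → ZGt (g i.1) (g j.1)}).Finite :=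
      Set.Finite.image _ (Filter.eventually_cofinite.1 hf)
    obtain ⟨b, hb⟩ := hfin.bddBelow
    refine ⟨min b (-1), by omega, fun i hi => ?_⟩
    by_contra hcon
    have hi0 : i < 0 := by omega
    have hi1 : i + 1 < 0 := by omega
    have := hb ⟨⟨i, hi0⟩, fun H => hcon (H ⟨i + 1, hi1⟩
      ⟨Subtype.mk_lt_mk.2 (by omega), fun c h1 h2 => by
        have h1 : i < c.1 := h1
        have h2 : c.1 < i + 1 := h2
        omega⟩), rfl⟩
    have : b ≤ i := this
    omega
  obtain ⟨m₀, hm₀, H⟩ := far_left hN (-1)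
  set d := intClass (g N) with hd
  set C := window g m₀ (-1) with hC
  set R := (finRS C d).headD [] with hR
  have hRl : (R.length : ℤ) ≤ -m₀ := by
    have := head_finRS_length C d
    rw [← hR, hC, window_length] at this
    omega
  obtain ⟨r, hr⟩ : ∃ r : ℕ, (r : ℤ) = -m₀ - R.length := ⟨(-m₀ - R.length).toNat, by omega⟩
  refine ⟨⟨d, fun i => glue g m₀ r R (i.1 - r), fun c => if c = d then (finRS C c).tail
    else finRS C c⟩, r, ?_⟩
  filter_upwards [Filter.eventually_ge_atTop (-m₀).toNat,
    Filter.eventually_gt_atTop R.length] with n hn hn'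
  rw [tail_restrict, tail_restrict (fun i => glue g m₀ r R (i - r))]
  have e1 : window (fun i => glue g m₀ r R (i - r)) (-n) (-1) =
      window g (-(n + r : ℕ)) (m₀ - 1) ++ R := by
    have := window_shift (glue g m₀ r R) (-n) (-1) (-r)
    simp only [← sub_eq_add_neg] at this
    rw [this, window_glue _ _ (by omega) (by omega)]
    have : window g (m₀ + R.length + r) (-1 - r + r) = [] := by
      rw [← List.length_eq_zero_iff, window_length]; omega
    rw [this, List.append_nil]
    congr 2
    push_cast; ring
  have e2 : window g (-(n + r : ℕ)) (-1) = window g (-(n + r : ℕ)) (m₀ - 1) ++ (C ++ []) := by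
    rw [List.append_nil, hC, ← window_append _ (by omega) (by omega)]
  have hA : ∀ a ∈ window g (-(n + r : ℕ)) (m₀ - 1), ∃ i < m₀, g i = a := by
    intro a ha
    obtain ⟨i, -, h2, rfl⟩ := mem_window.1 ha
    exact ⟨i, by omega, rfl⟩
  have S := finRS_sandwich (A := window g (-(n + r : ℕ)) (m₀ - 1)) (C := C) (B := []) (d := d)
    (by rw [Ne, ← List.length_eq_zero_iff, window_length]; omega)
    (by
      intro a ha
      obtain ⟨i, hi, rfl⟩ := hA a ha
      exact chain_class hN (by omega))
    (by simp)
    (window_pairwise fun i j _ h2 h3 => chain_gt hN h2 (by omega))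
    List.Pairwise.nil
    (by
      intro a ha y hy hc
      obtain ⟨i, hi, rfl⟩ := hA a ha
      obtain ⟨j, hj, hj', rfl⟩ := mem_window.1 hy
      exact H i hi.le j (by omega) hj' hc)
    (by simp) (by simp)
  funext c
  rw [e1, e2]
  by_cases hc : c = d
  · subst hc
    rw [(S _).1 rfl, List.append_nil]
    simp only [Output.withRow, if_true, ← hR]
  · rw [(S _).2 hc]
    simp [Output.withRow, hc]

theorem exists_output_two [CharZero F] {f : ℤ → F} (hf : StablyDecreasing f)
    (ha : AlmostIntegral f) : ∃ T, IsOutputTwo f T := by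
  classical
  obtain ⟨N, N', hNN, hN, hN'⟩ : ∃ N N', N < N' ∧ (∀ i < N, ZGt (f i) (f (i + 1))) ∧
      ∀ i ≥ N', ZGt (f i) (f (i + 1)) := by
    have hfin := Filter.eventually_cofinite.1 hf
    obtain ⟨b, hb⟩ := hfin.bddBelow
    obtain ⟨b', hb'⟩ := hfin.bddAbove
    have cov : ∀ i : ℤ, i ⋖ i + 1 := fun i => ⟨by omega, fun c h1 h2 => by omega⟩
    refine ⟨b, max b b' + 1, by omega, fun i hi => ?_, fun i hi => ?_⟩
    · by_contra hcon
      have := hb (show i ∈ _ from fun H => hcon (H _ (cov i)))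
      omega
    · by_contra hcon
      have := hb' (show i ∈ _ from fun H => hcon (H _ (cov i)))
      omega
  obtain ⟨hcl, hgt, n₀, hn₀, H'⟩ := far_right hN' N
  obtain ⟨m₀, hm₀, H⟩ := far_left hN N'
  have hdd : intClass (f N) = intClass (f N') := by
    have h1 : ∀ᶠ p : ℤ × ℤ in Filter.atBot ×ˢ Filter.atTop, p.1 ≤ N ∧ N' ≤ p.2 :=
      (Filter.eventually_le_atBot N).prod_mk (Filter.eventually_ge_atTop N')
    obtain ⟨p, hp, hp1, hp2⟩ := (Filter.Eventually.and ha h1).exists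
    rw [← chain_class hN hp1, ← hcl _ hp2]
    exact intClass_eq_iff.2 hp
  set d := intClass (f N) with hd
  have HL : ∀ m ≤ m₀, ∀ i, m < i → intClass (f i) = d → ZGt (f m) (f i) := by
    intro m hm i hi hc
    rcases le_or_gt i N' with h | h
    · exact H m hm i hi h hc
    · exact (H m hm N' (by omega) le_rfl hdd.symm).trans (hgt _ _ le_rfl h)
  have HR : ∀ n ≥ n₀, ∀ i, i < n → intClass (f i) = d → ZGt (f i) (f n) := by
    intro n hn i hi hc
    rcases le_or_gt N i with h | h
    · exact H' n hn i hi h (hc.trans hdd)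
    · exact (chain_gt hN h le_rfl).trans (H' n hn N (by omega) le_rfl hdd)
  set C := window f m₀ n₀ with hC
  set R := (finRS C d).headD [] with hR
  have hRl : (R.length : ℤ) ≤ n₀ + 1 - m₀ := by
    have := head_finRS_length C d
    rw [← hR, hC, window_length] at this
    omega
  obtain ⟨r, hr⟩ : ∃ r : ℕ, (r : ℤ) = n₀ + 1 - m₀ - R.length :=
    ⟨(n₀ + 1 - m₀ - R.length).toNat, by omega⟩
  refine ⟨⟨d, glue f m₀ r R, fun c => if c = d then (finRS C c).tail else finRS C c⟩, ?_, r, ?_⟩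
  · filter_upwards [Filter.eventually_lt_atBot m₀] with i hi
    simp [glue, hi]
  have hev : ∀ᶠ p : ℤ × ℤ in Filter.atBot ×ˢ Filter.atTop, p.1 < m₀ ∧ n₀ < p.2 :=
    (Filter.eventually_lt_atBot m₀).prod_mk (Filter.eventually_gt_atTop n₀)
  filter_upwards [hev] with p hp
  obtain ⟨m, n⟩ := p
  obtain ⟨hm, hn⟩ : m < m₀ ∧ n₀ < n := hp
  simp only
  have e1 := window_glue f (m := m) (m₁ := m₀) (n := n) (r := r) R (by omega) (by omega)
  rw [show m₀ + (R.length : ℤ) + r = n₀ + 1 by omega] at e1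
  have e2 : window f m (n + r) =
      window f m (m₀ - 1) ++ (C ++ window f (n₀ + 1) (n + r)) := by
    rw [window_append (k := m₀) _ (by omega) (by omega),
      window_append (m := m₀) (k := n₀ + 1) _ (by omega) (by omega), hC, add_sub_cancel_right]
  have hA : ∀ a ∈ window f m (m₀ - 1), ∃ i < m₀, f i = a := by
    intro a ha
    obtain ⟨i, -, h2, rfl⟩ := mem_window.1 ha
    exact ⟨i, by omega, rfl⟩
  have hB : ∀ a ∈ window f (n₀ + 1) (n + r), ∃ i > n₀, f i = a := by
    intro a ha
    obtain ⟨i, h2, -, rfl⟩ := mem_window.1 ha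
    exact ⟨i, by omega, rfl⟩
  have hBd : ∀ i > n₀, intClass (f i) = d := fun i hi => (hcl i (by omega)).trans hdd.symm
  have S := finRS_sandwich (A := window f m (m₀ - 1)) (C := C) (B := window f (n₀ + 1) (n + r))
    (d := d)
    (by rw [Ne, ← List.length_eq_zero_iff, window_length]; omega)
    (by
      intro a ha
      obtain ⟨i, hi, rfl⟩ := hA a ha
      exact chain_class hN (by omega))
    (by
      intro b hb
      obtain ⟨i, hi, rfl⟩ := hB b hb
      exact hBd i hi)
    (window_pairwise fun i j _ h2 h3 => chain_gt hN h2 (by omega))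
    (window_pairwise fun i j h1 h2 _ => hgt _ _ (by omega) h2)
    (by
      intro a ha y hy hc
      obtain ⟨i, hi, rfl⟩ := hA a ha
      obtain ⟨j, hj, hj', rfl⟩ := mem_window.1 hy
      exact HL i hi.le j (by omega) hc)
    (by
      intro a ha b hb
      obtain ⟨i, hi, rfl⟩ := hA a ha
      obtain ⟨j, hj, rfl⟩ := hB b hb
      exact HL i hi.le j (by omega) (hBd j hj))
    (by
      intro y hy hc b hb
      obtain ⟨i, hi, hi', rfl⟩ := mem_window.1 hy
      obtain ⟨j, hj, rfl⟩ := hB b hb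
      exact HR j hj.le i (by omega) hc)
  funext c
  rw [e1, e2]
  by_cases hc : c = d
  · subst hc
    rw [(S _).1 rfl]
    simp only [Output.withRow, if_true, ← hR]
  · rw [(S _).2 hc]
    simp [Output.withRow, hc]

theorem withRow_inj {ι : Type*} {T T' : Output F ι} {x x' y y' : List F}
    (hx : T.withRow x = T'.withRow x') (hy : T.withRow y = T'.withRow y')
    (hxy : x.length < y.length) : T.cls = T'.cls ∧ T.rest = T'.rest ∧ x = x' ∧ y = y' := by
  have hcls : T.cls = T'.cls := by
    by_contra hne
    have h1 := congrFun hx T.cls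
    have h2 := congrFun hy T.cls
    simp only [Output.withRow, if_true, if_neg hne] at h1 h2
    rw [← h2] at h1
    have := (List.cons.inj h1).1
    rw [this] at hxy
    exact lt_irrefl _ hxy
  have h1 := congrFun hx T.cls
  have h2 := congrFun hy T.cls
  simp only [Output.withRow, hcls, if_true] at h1 h2
  refine ⟨hcls, ?_, (List.cons.inj h1).1, (List.cons.inj h2).1⟩
  funext c
  by_cases hc : c = T'.cls
  · rw [hc]; exact (List.cons.inj h1).2
  · have h3 := congrFun hx c
    simpa [Output.withRow, hcls, hc] using h3

theorem output_left_unique {f : Set.Iio (0 : ℤ) → F} {T T' : Output F (Set.Iio (0 : ℤ))}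
    (h : IsOutputLeft f T) (h' : IsOutputLeft f T') : T = T' := by
  obtain ⟨r, h⟩ := h
  obtain ⟨r', h'⟩ := h'
  obtain ⟨n, hn⟩ := Filter.eventually_atTop.1 h
  obtain ⟨n', hn'⟩ := Filter.eventually_atTop.1 h'
  have key : ∀ k, T.withRow (tail T.firstRow (n + n' + r' + k)) =
      T'.withRow (tail T'.firstRow (n + n' + r + k)) := by
    intro k
    rw [← hn _ (by omega), ← hn' _ (by omega)]
    congr 2
    omega
  have key2 := fun k => withRow_inj (key k) (key (k + 1)) (by simp only [tail_length]; omega)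
  have hr : r = r' := by
    have := congrArg List.length (key2 0).2.2.1
    simp only [tail_length] at this
    omega
  subst hr
  refine Output.ext (key2 0).1 ?_ (key2 0).2.1
  funext i
  have hi : i.1 < 0 := i.2
  have e := (key2 (-i.1).toNat).2.2.1
  simp only [tail] at e
  have e' := congrFun (List.ofFn_injective e)
    ⟨(n + n' + r + (-i.1).toNat) - (-i.1).toNat, by omega⟩
  have hcast : ((((n + n' + r + (-i.1).toNat) - (-i.1).toNat : ℕ) : ℤ) -
      ((n + n' + r + (-i.1).toNat : ℕ) : ℤ)) = i.1 := by omega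
  simpa only [hcast] using e'

theorem output_two_unique {f : ℤ → F} {T T' : Output F ℤ}
    (h : IsOutputTwo f T) (h' : IsOutputTwo f T') : T = T' := by
  obtain ⟨-, r, h⟩ := h
  obtain ⟨-, r', h'⟩ := h'
  obtain ⟨p, hp, q, hq, hpq⟩ := Filter.eventually_prod_iff.1 (h.and
    ((Filter.tendsto_id.prodMap (Filter.tendsto_atTop_add_const_right _ ((r : ℤ) - r')
      Filter.tendsto_id)).eventually h'))
  obtain ⟨m, hm⟩ := Filter.eventually_atBot.1 hp
  obtain ⟨n, hn⟩ := Filter.eventually_atTop.1 hq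
  have key : ∀ i ≤ m, ∀ j ≥ n, T.withRow (window T.firstRow i j) =
      T'.withRow (window T'.firstRow i (j + (r - r'))) := by
    intro i hi j hj
    obtain ⟨h1, h2⟩ := hpq (hm i hi) (hn j hj)
    simp only [Prod.map, id] at h1 h2
    rw [← h1, ← h2]
    congr 2
    ring
  have key2 : ∀ i ≤ m, ∀ j ≥ n, i ≤ j → _ := fun i hi j hj hij =>
    withRow_inj (key i hi j hj) (key i hi (j + 1) (by omega))
      (by simp only [window_length]; omega)
  have k0 := key2 (min m n) (by omega) n le_rfl (by omega)
  have hr : (r : ℤ) - r' = 0 := by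
    have h1 := congrArg List.length k0.2.2.1
    have h2 := congrArg List.length k0.2.2.2
    simp only [window_length] at h1 h2
    omega
  refine Output.ext k0.1 ?_ k0.2.1
  funext i
  have e := (key2 (min m i) (by omega) (max n i) (by omega) (by omega)).2.2.1
  rw [hr, add_zero] at e
  have hl : (i - min m i).toNat < (window T.firstRow (min m i) (max n i)).length := by
    rw [window_length]; omega
  have e' : (window T.firstRow (min m i) (max n i))[(i - min m i).toNat] =
      (window T'.firstRow (min m i) (max n i))[(i - min m i).toNat]'(e ▸ hl) := by
    simp only [e]
  rw [window_getElem, window_getElem] at e'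
  rwa [show min m i + ((i - min m i).toNat : ℤ) = i by omega] at e'

theorem dual_stablyDecreasing {f : Set.Ioi (0 : ℤ) → F} (hf : StablyDecreasing f) :
    StablyDecreasing (dual f) := by
  have hfin := Filter.eventually_cofinite.1 hf
  refine Filter.eventually_cofinite.2 ?_
  refine Set.Finite.subset (hfin.image fun i : Set.Ioi (0 : ℤ) =>
    if h : -i.1 - 1 < 0 then (⟨-i.1 - 1, h⟩ : Set.Iio (0 : ℤ)) else ⟨-1, by simp⟩) ?_
  intro i hi
  simp only [Set.mem_ofPred_eq, not_forall] at hi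
  obtain ⟨j, hij, hj⟩ := hi
  have hi0 : i.1 < 0 := i.2
  have hj0 : j.1 < 0 := j.2
  have hlt : i.1 < j.1 := hij.1
  have hj1 : j.1 = i.1 + 1 := by
    by_contra hne
    have hk : i.1 + 1 < 0 := by omega
    exact hij.2 (c := ⟨i.1 + 1, hk⟩) (Subtype.mk_lt_mk.2 (by omega))
      (Subtype.mk_lt_mk.2 (by omega))
  have hp : -j.1 ∈ Set.Ioi (0 : ℤ) := by simp only [Set.mem_Ioi]; omega
  have hp' : -i.1 ∈ Set.Ioi (0 : ℤ) := by simp only [Set.mem_Ioi]; omega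
  refine ⟨⟨-j.1, hp⟩, fun H => hj ?_, ?_⟩
  · refine (H ⟨-i.1, hp'⟩ ⟨Subtype.mk_lt_mk.2 (by omega), fun c h1 h2 => ?_⟩).neg
    have h1 : -j.1 < c.1 := h1
    have h2 : c.1 < -i.1 := h2
    omega
  · have hneg : - -j.1 - 1 < 0 := by omega
    simp only [hneg, dif_pos]
    ext
    simp only
    omega

end WellDefined

/-! ### The infinite Robinson–Schensted output -/

section RS

variable {F : Type*} [Field F] [CharZero F]

/-- The output `RS(f)` of the infinite RS-algorithm for a stably decreasing `f : ℤ_{<0} → F`. -/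
noncomputable def RSLeft (f : Set.Iio (0 : ℤ) → F) (hf : StablyDecreasing f) :
    Output F (Set.Iio (0 : ℤ)) :=
  (exists_output_left hf).choose

/-- The output `RS(f)` of the infinite RS-algorithm for a stably decreasing `f : ℤ_{>0} → F`: the
algorithm is applied to `f*`, that is, starting from the infinite tail of `f`. -/
noncomputable def RSRight (f : Set.Ioi (0 : ℤ) → F) (hf : StablyDecreasing f) :
    Output F (Set.Iio (0 : ℤ)) :=
  RSLeft (dual f) (dual_stablyDecreasing hf)

/-- The output `RS(f)` of the infinite RS-algorithm for a stably decreasing almost integral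
`f : ℤ → F`. -/
noncomputable def RSTwo (f : ℤ → F) (hf : StablyDecreasing f) (ha : AlmostIntegral f) :
    Output F ℤ :=
  (exists_output_two hf ha).choose

/-- `RSLeft f` is the one and only output of the infinite RS-algorithm for `f`. -/
theorem isOutputLeft_iff {f : Set.Iio (0 : ℤ) → F} (hf : StablyDecreasing f)
    {T : Output F (Set.Iio (0 : ℤ))} : IsOutputLeft f T ↔ T = RSLeft f hf :=
  ⟨fun h => output_left_unique h (exists_output_left hf).choose_spec,
    fun h => h ▸ (exists_output_left hf).choose_spec⟩

/-- `RSTwo f` is the one and only output of the infinite RS-algorithm for `f`. -/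
theorem isOutputTwo_iff {f : ℤ → F} (hf : StablyDecreasing f) (ha : AlmostIntegral f)
    {T : Output F ℤ} : IsOutputTwo f T ↔ T = RSTwo f hf ha :=
  ⟨fun h => output_two_unique h (exists_output_two hf ha).choose_spec,
    fun h => h ▸ (exists_output_two hf ha).choose_spec⟩

end RS

end InfRS

/-! In one integrality class, write each value as `a₀ - z` with an integer `z`. This reverses the
order: `>_ℤ` becomes `<` on integers, and the position rule of `≺` becomes the convention that a
letter also bumps an equal letter, so that rows are strictly increasing. The finite algorithm is
then row insertion of integer words (`finRS_eq_tableau`). An interchange allowed by a neighbouring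
value lying between the two exchanged ones becomes an elementary Knuth transformation with that
neighbour as witness. An interchange of integrally unrelated values changes no class subword; since
such letters commute freely, a word can be sorted into its class subwords and each class treated
alone (`interchangeable_of_classPart`). For finite words the claim is therefore Knuth's theorem:
equal insertion tableaux mean Knuth equivalence.

Knuth's theorem is proved row by row. Inserting a word into an empty row leaves a row and a word of
bumped letters, and the rest of the tableau is the tableau of that shorter word
(`tableau_eq_insertWord`). A Knuth transformation keeps the row and changes the bumped word only up
to Knuth equivalence (`KnuthStep.insertWord`), so induction on the length gives
`KnuthEquiv.tableau_eq`. Conversely, a word is Knuth equivalent to the reading word of its tableau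
(`knuthEquiv_reading`).

For infinite sequences, an interchange together with its witness lies inside every large segment, so
it preserves the output. Conversely, a common output forces the finite outputs on large segments to
agree. It also determines the functions far out: enlarging a segment by one letter adds one entry to
the first row, and since insertion preserves the multiset of letters, this entry is that letter
(`eq_of_withRow`). So the two functions agree outside a finite segment, where the finite theorem
applies. The positive half-line is reflected to the negative one by `dual`. -/

namespace InfRS

/-! ### Row-by-row form of the insertion algorithm -/

section InsertWord

variable {α : Type*} {lt : α → α → Prop}

/-- Insert the letters of a word into a row one after the other; the output is the final row and
the word formed by the bumped entries. -/
noncomputable def insertWord (lt : α → α → Prop) : List α → List α → List α × List α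
  | r, [] => (r, [])
  | r, x :: w =>
    ((insertWord lt (rowInsert lt x r).1 w).1,
      (rowInsert lt x r).2.toList ++ (insertWord lt (rowInsert lt x r).1 w).2)

theorem insertWord_append (r u v : List α) :
    insertWord lt r (u ++ v) = ((insertWord lt (insertWord lt r u).1 v).1,
      (insertWord lt r u).2 ++ (insertWord lt (insertWord lt r u).1 v).2) := by
  induction u generalizing r with
  | nil => simp [insertWord]
  | cons x u ih => simp [insertWord, ih]

/-- Lower rows see the word only through the entries bumped from the first row, so rows can be
processed one after the other instead of letters. -/
theorem foldl_tabInsert_cons (r w : List α) (T : List (List α)) :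
    w.foldl (fun T x => tabInsert lt x T) (r :: T) =
      (insertWord lt r w).1 :: (insertWord lt r w).2.foldl (fun T x => tabInsert lt x T) T := by
  induction w generalizing r T with
  | nil => simp [insertWord]
  | cons x w ih =>
    rw [List.foldl_cons]
    simp only [tabInsert, insertWord]
    rcases rowInsert lt x r with ⟨r', _ | y⟩ <;> simp [ih]

theorem tableau_eq_insertWord {w : List α} (hw : w ≠ []) :
    tableau lt w = (insertWord lt [] w).1 :: tableau lt (insertWord lt [] w).2 := by
  cases w with
  | nil => exact absurd rfl hw
  | cons x w =>
    simp only [tableau, List.foldl_cons, tabInsert, foldl_tabInsert_cons, insertWord, rowInsert,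
      Option.toList_none, List.nil_append]

theorem rowInsert_perm (x : α) (r : List α) :
    ((rowInsert lt x r).2.toList ++ (rowInsert lt x r).1).Perm (x :: r) := by
  induction r with
  | nil => simp [rowInsert]
  | cons a r ih =>
    by_cases h : lt x a
    · simp only [rowInsert, h, if_true, Option.toList_some, List.singleton_append]
      exact List.Perm.swap _ _ _
    · simp only [rowInsert, h, if_false]
      refine List.perm_middle.trans ((ih.cons a).trans (List.Perm.swap _ _ _))

theorem tabInsert_flatten_perm (x : α) (T : List (List α)) :
    (tabInsert lt x T).flatten.Perm (x :: T.flatten) := by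
  induction T generalizing x with
  | nil => simp [tabInsert]
  | cons r T ih =>
    have h := rowInsert_perm (lt := lt) x r
    simp only [tabInsert]
    revert h
    rcases rowInsert lt x r with ⟨r', _ | y⟩ <;> intro h
    · simpa using h.append_right T.flatten
    · simp only [List.flatten_cons]
      refine ((ih y).append_left r').trans (List.perm_middle.trans ?_)
      simpa using h.append_right T.flatten

theorem tableau_flatten_perm (w : List α) : (tableau lt w).flatten.Perm w := by
  induction w using List.reverseRecOn with
  | nil => simp [tableau]
  | append_singleton w x ih =>
    rw [tableau_append_singleton]
    exact (tabInsert_flatten_perm x _).trans ((ih.cons x).trans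
      (List.perm_append_singleton x w).symm)

theorem insertWord_length (r w : List α) :
    (insertWord lt r w).2.length + (insertWord lt r w).1.length = w.length + r.length := by
  induction w generalizing r with
  | nil => simp [insertWord]
  | cons x w ih =>
    have h := (rowInsert_perm (lt := lt) x r).length_eq
    have := ih (rowInsert lt x r).1
    simp only [insertWord, List.length_append, List.length_cons] at h ⊢
    omega

theorem length_le_insertWord_fst (r w : List α) :
    r.length ≤ (insertWord lt r w).1.length := by
  induction w generalizing r with
  | nil => simp [insertWord]
  | cons x w ih =>
    refine le_trans ?_ (ih _)
    have h := (rowInsert_perm (lt := lt) x r).length_eq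
    rcases e : (rowInsert lt x r).2 with _ | y <;> simp [e] at h <;> omega

/-- The first letter fills a box and rows never shrink, so at least one letter stays. This is the
measure for all inductions over the rows of a tableau. -/
theorem insertWord_bumped_length_lt {w : List α} (hw : w ≠ []) :
    (insertWord lt [] w).2.length < w.length := by
  cases w with
  | nil => exact absurd rfl hw
  | cons x w =>
    have h1 := insertWord_length (lt := lt) [] (x :: w)
    have h2 : 1 ≤ (insertWord lt [] (x :: w)).1.length :=
      length_le_insertWord_fst (lt := lt) [x] w
    simp only [List.length_nil] at h1
    omega

end InsertWord

/-! ### Knuth equivalence and insertion tableaux -/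

section Knuth

variable {α : Type*} [LinearOrder α]

/-- The elementary Knuth transformations of words, for rows that are strictly increasing. -/
inductive KnuthStep : List α → List α → Prop
  | right (u v : List α) {x y z : α} (hxy : x < y) (hyz : y ≤ z) :
      KnuthStep (u ++ x :: z :: y :: v) (u ++ z :: x :: y :: v)
  | left (u v : List α) {x y z : α} (hxy : x ≤ y) (hyz : y < z) :
      KnuthStep (u ++ y :: x :: z :: v) (u ++ y :: z :: x :: v)

/-- Knuth equivalence of words. -/
def KnuthEquiv : List α → List α → Prop := Relation.EqvGen KnuthStep

theorem KnuthEquiv.refl (w : List α) : KnuthEquiv w w := Relation.EqvGen.refl w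

theorem KnuthStep.knuthEquiv {w w' : List α} (h : KnuthStep w w') : KnuthEquiv w w' :=
  Relation.EqvGen.rel _ _ h

theorem KnuthEquiv.symm {w w' : List α} (h : KnuthEquiv w w') : KnuthEquiv w' w :=
  Relation.EqvGen.symm _ _ h

theorem KnuthEquiv.trans {w w' w'' : List α} (h : KnuthEquiv w w') (h' : KnuthEquiv w' w'') :
    KnuthEquiv w w'' := Relation.EqvGen.trans _ _ _ h h'

theorem KnuthStep.append {w w' : List α} (h : KnuthStep w w') (p q : List α) :
    KnuthStep (p ++ w ++ q) (p ++ w' ++ q) := by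
  cases h with
  | right u v hxy hyz => simpa using KnuthStep.right (p ++ u) (v ++ q) hxy hyz
  | left u v hxy hyz => simpa using KnuthStep.left (p ++ u) (v ++ q) hxy hyz

theorem KnuthEquiv.append {w w' : List α} (h : KnuthEquiv w w') (p q : List α) :
    KnuthEquiv (p ++ w ++ q) (p ++ w' ++ q) := by
  induction h with
  | rel _ _ h => exact .rel _ _ (h.append p q)
  | refl _ => exact .refl _
  | symm _ _ _ ih => exact ih.symm
  | trans _ _ _ _ _ ih ih' => exact ih.trans ih'

theorem knuthEquiv_right {x y z : α} (hxy : x < y) (hyz : y ≤ z) (v : List α) :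
    KnuthEquiv (x :: z :: y :: v) (z :: x :: y :: v) := .rel _ _ (.right [] v hxy hyz)

theorem knuthEquiv_left {x y z : α} (hxy : x ≤ y) (hyz : y < z) (v : List α) :
    KnuthEquiv (y :: x :: z :: v) (y :: z :: x :: v) := .rel _ _ (.left [] v hxy hyz)

/-- Row insertion is used with `≤` as its relation: the first entry not smaller than the letter is
bumped, equal entries included. -/
theorem rowInsert_cons_of_le {x a : α} (h : x ≤ a) (r : List α) :
    rowInsert (· ≤ ·) x (a :: r) = (x :: r, some a) := by simp [rowInsert, h]

theorem rowInsert_cons_of_lt {x a : α} (h : a < x) (r : List α) :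
    rowInsert (· ≤ ·) x (a :: r) =
      (a :: (rowInsert (· ≤ ·) x r).1, (rowInsert (· ≤ ·) x r).2) := by
  simp [rowInsert, not_le.2 h]

theorem le_of_mem_bumped {x b : α} {r : List α} (h : b ∈ (rowInsert (· ≤ ·) x r).2) :
    x ≤ b ∧ b ∈ r := by
  induction r with
  | nil => simp [rowInsert] at h
  | cons a r ih =>
    rcases le_or_gt x a with hx | hx
    · rw [rowInsert_cons_of_le hx] at h
      simp only [Option.mem_def, Option.some.injEq] at h
      subst h
      simp [hx]
    · rw [rowInsert_cons_of_lt hx] at h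
      exact ⟨(ih h).1, List.mem_cons_of_mem _ (ih h).2⟩

theorem rowInsert_pairwise (x : α) {r : List α} (hr : r.Pairwise (· < ·)) :
    (rowInsert (· ≤ ·) x r).1.Pairwise (· < ·) := by
  induction r with
  | nil => simp [rowInsert]
  | cons a r ih =>
    rw [List.pairwise_cons] at hr
    rcases le_or_gt x a with hx | hx
    · rw [rowInsert_cons_of_le hx]
      exact List.pairwise_cons.2 ⟨fun b hb => hx.trans_lt (hr.1 b hb), hr.2⟩
    · rw [rowInsert_cons_of_lt hx]
      refine List.pairwise_cons.2 ⟨fun b hb => ?_, ih hr.2⟩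
      rcases rowInsert_mem r hb with rfl | hb
      · exact hx
      · exact hr.1 b hb

theorem insertWord_pairwise (w : List α) {r : List α} (hr : r.Pairwise (· < ·)) :
    (insertWord (· ≤ ·) r w).1.Pairwise (· < ·) := by
  induction w generalizing r with
  | nil => exact hr
  | cons x w ih => exact ih (rowInsert_pairwise x hr)

/-- After the insertion of `z`, an entry not larger than `z` bumps an entry not larger than `z`. -/
theorem exists_bumped_le {y z : α} (hyz : y ≤ z) (r : List α) :
    ∃ d ≤ z, (rowInsert (· ≤ ·) y (rowInsert (· ≤ ·) z r).1).2 = some d := by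
  induction r with
  | nil => exact ⟨z, le_rfl, by simp [rowInsert, hyz]⟩
  | cons a r ih =>
    rcases le_or_gt z a with hz | hz
    · rw [rowInsert_cons_of_le hz, rowInsert_cons_of_le hyz]
      exact ⟨z, le_rfl, rfl⟩
    · rw [rowInsert_cons_of_lt hz]
      rcases le_or_gt y a with hy | hy
      · rw [rowInsert_cons_of_le hy]
        exact ⟨a, hz.le, rfl⟩
      · rw [rowInsert_cons_of_lt hy]
        exact ih

/-- If `y < z` are inserted one after the other and `z` bumps `c`, then `y` bumps some `b < c`. -/
theorem exists_bumped_lt {y z c : α} (hyz : y < z) {r : List α} (hr : r.Pairwise (· < ·))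
    (hc : (rowInsert (· ≤ ·) z (rowInsert (· ≤ ·) y r).1).2 = some c) :
    ∃ b < c, (rowInsert (· ≤ ·) y r).2 = some b := by
  induction r with
  | nil => simp [rowInsert, not_le.2 hyz] at hc
  | cons a r ih =>
    rw [List.pairwise_cons] at hr
    rcases le_or_gt y a with hy | hy
    · rw [rowInsert_cons_of_le hy] at hc ⊢
      rw [rowInsert_cons_of_lt hyz] at hc
      exact ⟨a, hr.1 _ (le_of_mem_bumped hc).2, rfl⟩
    · rw [rowInsert_cons_of_lt hy] at hc ⊢
      rw [rowInsert_cons_of_lt (hy.trans hyz)] at hc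
      exact ih hr.2 hc

/-- An entry below all letters never moves. Splitting it off reduces the case analyses below to rows
whose first entry is at least the smallest letter. -/
theorem insertWord_cons_of_lt {a : α} (r : List α) {w : List α} (hw : ∀ x ∈ w, a < x) :
    insertWord (· ≤ ·) (a :: r) w =
      (a :: (insertWord (· ≤ ·) r w).1, (insertWord (· ≤ ·) r w).2) := by
  induction w generalizing r with
  | nil => rfl
  | cons x w ih =>
    rw [List.forall_mem_cons] at hw
    simp only [insertWord, rowInsert_cons_of_lt hw.1, ih _ hw.2]

/-- Once the first entry `a` satisfies `x ≤ a`, the letter `x` ends up in its place in either order,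
and only the order of the bumped letters can differ. -/
theorem insertWord_right {x y z : α} (hxy : x < y) (hyz : y ≤ z) {r : List α}
    (hr : r.Pairwise (· < ·)) :
    (insertWord (· ≤ ·) r [x, z, y]).1 = (insertWord (· ≤ ·) r [z, x, y]).1 ∧
      KnuthEquiv (insertWord (· ≤ ·) r [x, z, y]).2 (insertWord (· ≤ ·) r [z, x, y]).2 := by
  have hxz := hxy.trans_le hyz
  induction r with
  | nil =>
    simp [insertWord, rowInsert, not_le.2 hxy, not_le.2 hxz, hyz, hxz.le, KnuthEquiv.refl]
  | cons a r ih =>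
    rw [List.pairwise_cons] at hr
    rcases lt_or_ge a x with hx | hx
    · rw [insertWord_cons_of_lt r (by simp [hx, hx.trans hxy, hx.trans hxz]),
        insertWord_cons_of_lt r (by simp [hx, hx.trans hxy, hx.trans hxz])]
      exact ⟨congrArg (a :: ·) (ih hr.2).1, (ih hr.2).2⟩
    · rcases lt_or_ge a z with hz | hz
      · simp only [insertWord, rowInsert_cons_of_le hx, rowInsert_cons_of_lt hxz,
          rowInsert_cons_of_lt hxy, rowInsert_cons_of_lt hz, true_and]
        -- Here `z` and `y` pass the first entry. If `z` bumps `c` and then `y` bumps `d`, the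
        -- bumped words are `a c d` and `c a d` with `a < d ≤ z ≤ c`. If `z` bumps nothing, both are
        -- `a d`.
        obtain ⟨d, hd, e⟩ := exists_bumped_le hyz r
        rw [e]
        rcases e' : (rowInsert (· ≤ ·) z r).2 with _ | c
        · exact .refl _
        · have had : a < d := by
            have hm := (le_of_mem_bumped e).2
            rcases rowInsert_mem r hm with rfl | hm
            · exact hz
            · exact hr.1 _ hm
          exact knuthEquiv_right had (hd.trans (le_of_mem_bumped e').1) []
      · cases r with
        | nil =>
          simp [insertWord, rowInsert, hx, hz, not_le.2 hxy, not_le.2 hxz, hyz, hxz.le,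
            KnuthEquiv.refl]
        | cons b r =>
          have hab := hr.1 b (by simp)
          have hzb := hz.trans hab.le
          simp only [insertWord, rowInsert_cons_of_le hx, rowInsert_cons_of_lt hxz,
            rowInsert_cons_of_lt hxy, rowInsert_cons_of_le hz, rowInsert_cons_of_le hzb,
            rowInsert_cons_of_le hyz, rowInsert_cons_of_le hxz.le,
            rowInsert_cons_of_le (hyz.trans hzb), true_and]
          -- The bumped words are `a b z` and `a z b` with `z ≤ a < b`: a transformation of one kind
          -- turns into the other kind in the next row.
          exact (knuthEquiv_left hz hab []).symm

/-- When `x ≤ a`, the letter `x` acts on the first box and `z` only on the remaining ones, so the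
two insertions commute. If `z` bumps `c`, the letter bumped by `y` precedes both outputs and serves
as the witness. -/
theorem insertWord_left {x y z : α} (hxy : x ≤ y) (hyz : y < z) {r : List α}
    (hr : r.Pairwise (· < ·)) :
    (insertWord (· ≤ ·) r [y, x, z]).1 = (insertWord (· ≤ ·) r [y, z, x]).1 ∧
      KnuthEquiv (insertWord (· ≤ ·) r [y, x, z]).2 (insertWord (· ≤ ·) r [y, z, x]).2 := by
  have hxz := hxy.trans_lt hyz
  induction r with
  | nil =>
    simp [insertWord, rowInsert, not_le.2 hyz, not_le.2 hxz, hxy, KnuthEquiv.refl]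
  | cons a r ih =>
    rw [List.pairwise_cons] at hr
    rcases lt_or_ge a x with hx | hx
    · have : ∀ u ∈ [y, x, z], a < u := by simp [hx, hx.trans_le hxy, hx.trans hxz]
      rw [insertWord_cons_of_lt r this, insertWord_cons_of_lt r (by simp_all)]
      exact ⟨congrArg (a :: ·) (ih hr.2).1, (ih hr.2).2⟩
    · rcases lt_or_ge a y with hy | hy
      · simp only [insertWord, rowInsert_cons_of_lt hy, rowInsert_cons_of_le hx,
          rowInsert_cons_of_lt hxz, rowInsert_cons_of_lt (hy.trans hyz), true_and]
        rcases e : (rowInsert (· ≤ ·) z (rowInsert (· ≤ ·) y r).1).2 with _ | c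
        · exact .refl _
        · obtain ⟨b, hbc, e'⟩ := exists_bumped_lt hyz hr.2 e
          rw [e']
          exact knuthEquiv_left (hr.1 _ (le_of_mem_bumped e').2).le hbc []
      · simp only [insertWord, rowInsert_cons_of_le hy, rowInsert_cons_of_le hxy,
          rowInsert_cons_of_lt hxz, rowInsert_cons_of_lt hyz, true_and]
        rcases e : (rowInsert (· ≤ ·) z r).2 with _ | c
        · exact .refl _
        · exact knuthEquiv_left hy (hr.1 _ (le_of_mem_bumped e).2) []

theorem insertWord_knuth_congr {r p q : List α}
    (h : (insertWord (· ≤ ·) r p).1 = (insertWord (· ≤ ·) r q).1 ∧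
      KnuthEquiv (insertWord (· ≤ ·) r p).2 (insertWord (· ≤ ·) r q).2) (v : List α) :
    (insertWord (· ≤ ·) r (p ++ v)).1 = (insertWord (· ≤ ·) r (q ++ v)).1 ∧
      KnuthEquiv (insertWord (· ≤ ·) r (p ++ v)).2 (insertWord (· ≤ ·) r (q ++ v)).2 := by
  simp only [insertWord_append, h.1, true_and]
  exact h.2.append [] _

theorem KnuthStep.insertWord {w w' : List α} (h : KnuthStep w w') :
    (insertWord (· ≤ ·) [] w).1 = (insertWord (· ≤ ·) [] w').1 ∧
      KnuthEquiv (insertWord (· ≤ ·) [] w).2 (insertWord (· ≤ ·) [] w').2 := by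
  cases h with
  | right u v hxy hyz =>
    have := insertWord_knuth_congr
      (insertWord_right hxy hyz (insertWord_pairwise u List.Pairwise.nil)) v
    rw [insertWord_append, insertWord_append]
    exact ⟨this.1, by simpa using this.2.append (InfRS.insertWord (· ≤ ·) [] u).2 []⟩
  | left u v hxy hyz =>
    have := insertWord_knuth_congr
      (insertWord_left hxy hyz (insertWord_pairwise u List.Pairwise.nil)) v
    rw [insertWord_append, insertWord_append]
    exact ⟨this.1, by simpa using this.2.append (InfRS.insertWord (· ≤ ·) [] u).2 []⟩

theorem KnuthEquiv.insertWord {w w' : List α} (h : KnuthEquiv w w') :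
    (insertWord (· ≤ ·) [] w).1 = (insertWord (· ≤ ·) [] w').1 ∧
      KnuthEquiv (insertWord (· ≤ ·) [] w).2 (insertWord (· ≤ ·) [] w').2 := by
  induction h with
  | rel _ _ h => exact h.insertWord
  | refl _ => exact ⟨rfl, .refl _⟩
  | symm _ _ _ ih => exact ⟨ih.1.symm, ih.2.symm⟩
  | trans _ _ _ _ _ ih ih' => exact ⟨ih.1.trans ih'.1, ih.2.trans ih'.2⟩

theorem KnuthStep.perm {w w' : List α} (h : KnuthStep w w') : w.Perm w' := by
  cases h with
  | right u v _ _ => exact (List.Perm.swap _ _ _).append_left u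
  | left u v _ _ => exact ((List.Perm.swap _ _ _).cons _).append_left u

theorem KnuthEquiv.perm {w w' : List α} (h : KnuthEquiv w w') : w.Perm w' := by
  induction h with
  | rel _ _ h => exact h.perm
  | refl _ => exact .refl _
  | symm _ _ _ ih => exact ih.symm
  | trans _ _ _ _ _ ih ih' => exact ih.trans ih'

/-- Knuth equivalent words have the same insertion tableau. -/
theorem KnuthEquiv.tableau_eq {w w' : List α} (h : KnuthEquiv w w') :
    tableau (· ≤ ·) w = tableau (· ≤ ·) w' := by
  induction hn : w.length using Nat.strong_induction_on generalizing w w' with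
  | _ n ih =>
    by_cases hw : w = []
    · subst hw
      rw [h.perm.symm.eq_nil]
    · have hw' : w' ≠ [] := fun e => hw (e ▸ h.perm).eq_nil
      rw [tableau_eq_insertWord hw, tableau_eq_insertWord hw', h.insertWord.1,
        ih _ (hn ▸ insertWord_bumped_length_lt hw) h.insertWord.2 rfl]

/-- The letter `x` moves left through `s` one step at a time. Each entry it passes is preceded by a
smaller entry that is still at least `x`, and this predecessor is the witness. -/
theorem knuthEquiv_move_left {x a : α} (hxa : x ≤ a) {s : List α}
    (hs : (a :: s).Pairwise (· < ·)) : KnuthEquiv (a :: (s ++ [x])) (a :: x :: s) := by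
  induction s generalizing a with
  | nil => exact .refl _
  | cons t s ih =>
    have hat : a < t := (List.pairwise_cons.1 hs).1 t (by simp)
    have := (ih (hxa.trans hat.le) (List.pairwise_cons.1 hs).2).append [a] []
    simp only [List.append_nil] at this
    exact this.trans (knuthEquiv_left hxa hat s).symm

/-- The letter `x` first moves left until it stands directly after the entry it bumps. That entry
then moves left past the entries below `x`, each time with the letter to the right of the exchanged
pair as witness. -/
theorem rowInsert_knuthEquiv (x : α) {r : List α} (hr : r.Pairwise (· < ·)) :
    KnuthEquiv (r ++ [x])
      ((rowInsert (· ≤ ·) x r).2.toList ++ (rowInsert (· ≤ ·) x r).1) := by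
  induction r with
  | nil => exact .refl _
  | cons a s ih =>
    rcases le_or_gt x a with hx | hx
    · rw [rowInsert_cons_of_le hx]
      exact knuthEquiv_move_left hx hr
    · rw [rowInsert_cons_of_lt hx]
      rw [List.pairwise_cons] at hr
      have h1 := (ih hr.2).append [a] []
      simp only [List.append_nil] at h1
      refine h1.trans ?_
      rcases e : (rowInsert (· ≤ ·) x s).2 with _ | b
      · exact .refl _
      · cases s with
        | nil => simp [rowInsert] at e
        | cons t s =>
          have hat := hr.1 t (by simp)
          rcases le_or_gt x t with ht | ht
          · rw [rowInsert_cons_of_le ht] at e ⊢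
            cases e
            exact knuthEquiv_right hx ht s
          · rw [rowInsert_cons_of_lt ht] at e ⊢
            exact knuthEquiv_right hat (ht.le.trans (le_of_mem_bumped e).1) _

theorem insertWord_knuthEquiv (w : List α) {r : List α} (hr : r.Pairwise (· < ·)) :
    KnuthEquiv (r ++ w) ((insertWord (· ≤ ·) r w).2 ++ (insertWord (· ≤ ·) r w).1) := by
  induction w generalizing r with
  | nil => simpa [insertWord] using KnuthEquiv.refl r
  | cons x w ih =>
    have h1 := (rowInsert_knuthEquiv x hr).append [] w
    have h2 := (ih (rowInsert_pairwise x hr)).append (rowInsert (· ≤ ·) x r).2.toList []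
    simp only [List.nil_append, List.append_nil, List.append_assoc, List.singleton_append]
      at h1 h2
    simpa [insertWord] using h1.trans h2

/-- Every word is Knuth equivalent to the reading word of its insertion tableau. -/
theorem knuthEquiv_reading (w : List α) :
    KnuthEquiv w (tableau (· ≤ ·) w).reverse.flatten := by
  induction hn : w.length using Nat.strong_induction_on generalizing w with
  | _ n ih =>
    by_cases hw : w = []
    · subst hw
      exact .refl _
    · have h1 := insertWord_knuthEquiv w List.Pairwise.nil
      have h2 := (ih _ (hn ▸ insertWord_bumped_length_lt (lt := (· ≤ ·)) hw) _ rfl).append []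
        (insertWord (· ≤ ·) [] w).1
      rw [tableau_eq_insertWord hw]
      simpa using h1.trans h2

theorem knuthEquiv_of_tableau_eq {w w' : List α}
    (h : tableau (· ≤ ·) w = tableau (· ≤ ·) w') : KnuthEquiv w w' :=
  (knuthEquiv_reading w).trans (h ▸ (knuthEquiv_reading w').symm)

end Knuth

/-! ### Eliminating the positions -/

section Standardization

variable {α : Type*} [LinearOrder α]

/-- The order on pairs `(value, position)` in which equal values are ordered by decreasing
position. -/
def LexPrec (p q : α × ℕ) : Prop := p.1 < q.1 ∨ (p.1 = q.1 ∧ q.2 < p.2)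

/-- The hypothesis says that an inserted pair is later than a row entry of equal value. As long as
insertion preserves this, positions never influence a comparison. -/
theorem lexPrec_iff {p q : α × ℕ} (h : p.1 = q.1 → q.2 < p.2) : LexPrec p q ↔ p.1 ≤ q.1 := by
  rw [LexPrec, le_iff_lt_or_eq]
  tauto

theorem rowInsert_lexPrec {p : α × ℕ} {r : List (α × ℕ)}
    (h : ∀ q ∈ r, p.1 = q.1 → q.2 < p.2) :
    rowInsert (· ≤ ·) p.1 (r.map Prod.fst) =
      ((rowInsert LexPrec p r).1.map Prod.fst, (rowInsert LexPrec p r).2.map Prod.fst) := by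
  induction r with
  | nil => simp [rowInsert]
  | cons q r ih =>
    rw [List.forall_mem_cons] at h
    by_cases hpq : p.1 ≤ q.1
    · simp [rowInsert, hpq, (lexPrec_iff h.1).2 hpq]
    · simp [rowInsert, hpq, mt (lexPrec_iff h.1).1 hpq, ih h.2]

/-- Values in a row are distinct, so only the inserted pair can share its value with the bumped one,
and the inserted pair is later. -/
theorem rowInsert_lexPrec_bumped {p b : α × ℕ} {r : List (α × ℕ)}
    (hr : (r.map Prod.fst).Pairwise (· < ·)) (h : ∀ q ∈ r, p.1 = q.1 → q.2 < p.2)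
    (hb : b ∈ (rowInsert LexPrec p r).2) :
    b ∈ r ∧ ∀ q ∈ (rowInsert LexPrec p r).1, b.1 = q.1 → b.2 < q.2 := by
  induction r with
  | nil => simp [rowInsert] at hb
  | cons a r ih =>
    rw [List.forall_mem_cons] at h
    rw [List.map_cons, List.pairwise_cons] at hr
    by_cases hpa : LexPrec p a
    · simp only [rowInsert, hpa, if_true, Option.mem_def, Option.some.injEq] at hb ⊢
      subst hb
      refine ⟨by simp, fun q hq e => ?_⟩
      rcases List.mem_cons.1 hq with rfl | hq
      · exact h.1 e.symm
      · exact absurd e (hr.1 _ (List.mem_map_of_mem hq)).ne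
    · simp only [rowInsert, hpa, if_false] at hb ⊢
      obtain ⟨h1, h2⟩ := ih hr.2 h.2 hb
      refine ⟨List.mem_cons_of_mem _ h1, fun q hq e => ?_⟩
      rcases List.mem_cons.1 hq with rfl | hq
      · exact absurd e (hr.1 _ (List.mem_map_of_mem h1)).ne'
      · exact h2 q hq e

/-- A word of pairs is standard if equal values occur with increasing positions. -/
def Standard (w : List (α × ℕ)) : Prop := w.Pairwise fun p q => p.1 = q.1 → p.2 < q.2

/-- The invariant is that row entries precede all coming letters of equal value. A later bumped pair
comes from the current row or from the remaining word, hence the bumped word is again standard and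
the next row can be treated in the same way. -/
theorem insertWord_lexPrec {r w : List (α × ℕ)} (hr : (r.map Prod.fst).Pairwise (· < ·))
    (hw : Standard w) (hrw : ∀ q ∈ r, ∀ p ∈ w, q.1 = p.1 → q.2 < p.2) :
    insertWord (· ≤ ·) (r.map Prod.fst) (w.map Prod.fst) =
      ((insertWord LexPrec r w).1.map Prod.fst, (insertWord LexPrec r w).2.map Prod.fst) ∧
    Standard (insertWord LexPrec r w).2 ∧
    ∀ p ∈ (insertWord LexPrec r w).2, p ∈ r ∨ p ∈ w := by
  induction w generalizing r with
  | nil => simp [insertWord, Standard]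
  | cons p w ih =>
    obtain ⟨hp, hw⟩ := List.pairwise_cons.1 hw
    have hpr : ∀ q ∈ r, p.1 = q.1 → q.2 < p.2 := fun q hq e => hrw q hq p (by simp) e.symm
    have e := rowInsert_lexPrec hpr
    have hmem : ∀ q ∈ (rowInsert LexPrec p r).1, q = p ∨ q ∈ r := fun q hq => rowInsert_mem r hq
    obtain ⟨h1, h2, h3⟩ := ih (r := (rowInsert LexPrec p r).1)
      (by have := rowInsert_pairwise p.1 hr; rwa [e] at this) hw (by
        intro q hq s hs
        rcases hmem q hq with rfl | hq
        · exact hp s hs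
        · exact hrw q hq s (by simp [hs]))
    have h4 : ∀ b ∈ (rowInsert LexPrec p r).2, b ∈ r ∧ _ := fun b hb =>
      rowInsert_lexPrec_bumped hr hpr hb
    have h5 : ∀ q ∈ (insertWord LexPrec (rowInsert LexPrec p r).1 w).2, q ∈ r ∨ q ∈ p :: w := by
      intro q hq
      rcases h3 q hq with hq | hq
      · rcases hmem q hq with rfl | hq
        · simp
        · exact .inl hq
      · simp [hq]
    simp only [List.map_cons, insertWord, e, h1]
    rcases eb : (rowInsert LexPrec p r).2 with _ | b
    · simpa using ⟨h2, fun a b => by simpa using h5 (a, b)⟩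
    · obtain ⟨hb, hb'⟩ := h4 b eb
      refine ⟨by simp, List.pairwise_cons.2 ⟨fun q hq => ?_, h2⟩, fun q hq => ?_⟩
      · rcases h3 q hq with hq | hq
        · exact hb' q hq
        · exact hrw b hb q (by simp [hq])
      · rcases List.mem_cons.1 hq with rfl | hq
        · exact .inl hb
        · exact h5 q hq

theorem tableau_lexPrec {w : List (α × ℕ)} (hw : Standard w) :
    (tableau LexPrec w).map (List.map Prod.fst) = tableau (· ≤ ·) (w.map Prod.fst) := by
  induction hn : w.length using Nat.strong_induction_on generalizing w with
  | _ n ih =>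
    by_cases h0 : w = []
    · simp [h0, tableau]
    · obtain ⟨h1, h2, -⟩ := insertWord_lexPrec (r := []) List.Pairwise.nil hw (by simp)
      rw [List.map_nil] at h1
      rw [tableau_eq_insertWord h0, tableau_eq_insertWord (w := w.map Prod.fst) (by simpa using h0),
        h1, List.map_cons, ih _ (hn ▸ insertWord_bumped_length_lt h0) h2 rfl]

end Standardization

/-! ### Admissible interchanges of finite words -/

section Words

variable {F : Type*} [Field F]

/-- Words connected by an admissible interchange of two neighbouring letters. -/
def Interchange (w w' : List F) : Prop :=
  ∃ u v a b, w = u ++ a :: b :: v ∧ w' = u ++ b :: a :: v ∧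
    ((¬ ∃ z : ℤ, b - a = (z : F)) ∨
     (∃ c ∈ v.head?, ZGt b c ∧ ZGe c a) ∨
     (∃ c ∈ v.head?, ZGt a c ∧ ZGe c b) ∨
     (∃ c ∈ u.getLast?, ZGe b c ∧ ZGt c a) ∨
     (∃ c ∈ u.getLast?, ZGe a c ∧ ZGt c b))

/-- Words connected by a finite series of admissible interchanges. -/
def Interchangeable : List F → List F → Prop := Relation.ReflTransGen Interchange

theorem Interchange.symm {w w' : List F} (h : Interchange w w') : Interchange w' w := by
  obtain ⟨u, v, a, b, rfl, rfl, h⟩ := h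
  refine ⟨u, v, b, a, rfl, rfl, ?_⟩
  rcases h with h | h | h | h | h
  · exact .inl fun ⟨z, hz⟩ => h ⟨-z, by push_cast; linear_combination -hz⟩
  · exact .inr (.inr (.inl h))
  · exact .inr (.inl h)
  · exact .inr (.inr (.inr (.inr h)))
  · exact .inr (.inr (.inr (.inl h)))

theorem Interchange.append {w w' : List F} (h : Interchange w w') (p q : List F) :
    Interchange (p ++ w ++ q) (p ++ w' ++ q) := by
  obtain ⟨u, v, a, b, rfl, rfl, h⟩ := h
  have hv : ∀ c ∈ v.head?, c ∈ (v ++ q).head? := by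
    intro c hc
    rw [List.head?_append, Option.mem_def.1 hc, Option.some_or, Option.mem_def]
  have hu : ∀ c ∈ u.getLast?, c ∈ (p ++ u).getLast? := by
    intro c hc
    rw [List.getLast?_append, Option.mem_def.1 hc, Option.some_or, Option.mem_def]
  refine ⟨p ++ u, v ++ q, a, b, by simp, by simp, ?_⟩
  rcases h with h | ⟨c, hc, h⟩ | ⟨c, hc, h⟩ | ⟨c, hc, h⟩ | ⟨c, hc, h⟩
  · exact .inl h
  · exact .inr (.inl ⟨c, hv c hc, h⟩)
  · exact .inr (.inr (.inl ⟨c, hv c hc, h⟩))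
  · exact .inr (.inr (.inr (.inl ⟨c, hu c hc, h⟩)))
  · exact .inr (.inr (.inr (.inr ⟨c, hu c hc, h⟩)))

theorem Interchange.perm {w w' : List F} (h : Interchange w w') : w.Perm w' := by
  obtain ⟨u, v, a, b, rfl, rfl, -⟩ := h
  exact (List.Perm.swap _ _ _).append_left u

theorem Interchangeable.symm {w w' : List F} (h : Interchangeable w w') :
    Interchangeable w' w := by
  induction h with
  | refl => exact .refl
  | tail _ h ih => exact .head h.symm ih

theorem Interchangeable.trans {w w' w'' : List F} (h : Interchangeable w w')
    (h' : Interchangeable w' w'') : Interchangeable w w'' := Relation.ReflTransGen.trans h h'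

theorem Interchangeable.append {w w' : List F} (h : Interchangeable w w') (p q : List F) :
    Interchangeable (p ++ w ++ q) (p ++ w' ++ q) :=
  Relation.ReflTransGen.lift (fun w => p ++ w ++ q) (fun _ _ h => h.append p q) _ _ h

theorem Interchangeable.perm {w w' : List F} (h : Interchangeable w w') : w.Perm w' := by
  induction h with
  | refl => exact .refl _
  | tail _ h ih => exact ih.trans h.perm

open Classical in
/-- The letters of a word which lie in the integrality class `c`. -/
noncomputable def classPart (c : IntClass F) (w : List F) : List F :=
  w.filter fun a => decide (intClass a = c)

open Classical in
/-- The letters of a word which do not lie in the integrality class `c`. -/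
noncomputable def classCompl (c : IntClass F) (w : List F) : List F :=
  w.filter fun a => decide (intClass a ≠ c)

theorem mem_classPart {c : IntClass F} {w : List F} {a : F} :
    a ∈ classPart c w ↔ a ∈ w ∧ intClass a = c := by simp [classPart]

theorem classPart_append (c : IntClass F) (v w : List F) :
    classPart c (v ++ w) = classPart c v ++ classPart c w := by simp [classPart]

theorem classPart_cons_of_eq {c : IntClass F} {a : F} (h : intClass a = c) (w : List F) :
    classPart c (a :: w) = a :: classPart c w := by simp [classPart, h]

theorem classPart_cons_of_ne {c : IntClass F} {a : F} (h : intClass a ≠ c) (w : List F) :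
    classPart c (a :: w) = classPart c w := by simp [classPart, h]

theorem classPart_classCompl_self (c : IntClass F) (w : List F) :
    classPart c (classCompl c w) = [] := by
  rw [List.eq_nil_iff_forall_not_mem]
  intro a ha
  rw [mem_classPart, classCompl, List.mem_filter, decide_eq_true_iff] at ha
  exact ha.1.2 ha.2

theorem classPart_classCompl_of_ne {c d : IntClass F} (h : d ≠ c) (w : List F) :
    classPart d (classCompl c w) = classPart d w := by
  rw [classPart, classCompl, List.filter_filter]
  refine List.filter_congr fun a _ => ?_
  by_cases ha : intClass a = d <;> simp [ha, h]

theorem map_fst_part_eq (w : List F) (k : ℕ) (c : IntClass F) :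
    (part w k c).map Prod.fst = classPart c w := by
  have : (w.zipIdx k).map Prod.fst = w := List.zipIdx_map_fst k w
  conv_rhs => rw [← this]
  rw [classPart, List.filter_map]
  rfl

theorem pairwise_snd_part (w : List F) (k : ℕ) (c : IntClass F) :
    (part w k c).Pairwise fun p q => p.2 < q.2 := by
  refine List.Pairwise.sublist List.filter_sublist ?_
  have : ((w.zipIdx k).map Prod.snd).Pairwise (· < ·) := by
    rw [List.zipIdx_map_snd]
    exact List.pairwise_lt_range'
  exact List.pairwise_map.1 this

theorem finRS_flatten_perm (w : List F) (c : IntClass F) :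
    (finRS w c).flatten.Perm (classPart c w) := by
  rw [← finRS_shift w 1, ← List.map_flatten, ← map_fst_part_eq w 1]
  exact (tableau_flatten_perm _).map _

theorem interchange_of_ne {a b : F} (h : intClass a ≠ intClass b) (v : List F) :
    Interchange (a :: b :: v) (b :: a :: v) :=
  ⟨[], v, a, b, rfl, rfl, .inl fun hz => h (intClass_eq_iff.2 hz)⟩

theorem interchangeable_move_right {a : F} {p : List F} (h : ∀ b ∈ p, intClass a ≠ intClass b)
    (q : List F) : Interchangeable (a :: (p ++ q)) (p ++ a :: q) := by
  induction p with
  | nil => exact .refl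
  | cons b p ih =>
    rw [List.forall_mem_cons] at h
    have h' := (ih h.2).append [b] []
    simp only [List.append_nil, List.singleton_append] at h'
    exact .head (interchange_of_ne h.1 _) h'

/-- Letters of different classes may always be exchanged, so the letters of `c` can be brought to
the front without changing the order within `c` or within its complement. -/
theorem interchangeable_sort (c : IntClass F) (w : List F) :
    Interchangeable w (classPart c w ++ classCompl c w) := by
  induction w with
  | nil => exact .refl
  | cons a w ih =>
    have h := ih.append [a] []
    simp only [List.append_nil, List.singleton_append] at h
    by_cases ha : intClass a = c
    · simpa [classPart, classCompl, ha] using h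
    · have h' := interchangeable_move_right (a := a) (p := classPart c w)
        (fun b hb e => ha (e.trans (mem_classPart.1 hb).2)) (classCompl c w)
      simpa [classPart, classCompl, ha] using h.trans h'

/-- Words are connected by admissible interchanges if their parts in all classes are. -/
theorem interchangeable_of_classPart {w w' : List F}
    (h : ∀ c, Interchangeable (classPart c w) (classPart c w')) : Interchangeable w w' := by
  induction hn : w.length using Nat.strong_induction_on generalizing w w' with
  | _ n ih =>
    cases w with
    | nil =>
      cases w' with
      | nil => exact .refl
      | cons a w' =>
        have := (h (intClass a)).perm.symm.subset (mem_classPart.2 ⟨List.mem_cons_self, rfl⟩)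
        simp [classPart] at this
    | cons a w =>
      set c := intClass a with hc
      -- Removing the class of the first letter shortens the word, so the induction applies to the
      -- complements.
      have h1 : Interchangeable (classCompl c (a :: w)) (classCompl c w') := by
        refine ih _ ?_ (fun d => ?_) rfl
        · rw [← hn]
          refine List.length_filter_lt_length_iff_exists.2 ⟨a, by simp, by simp [hc]⟩
        · by_cases hd : d = c
          · rw [hd, classPart_classCompl_self, classPart_classCompl_self]
            exact .refl
          · rw [classPart_classCompl_of_ne hd, classPart_classCompl_of_ne hd]
            exact h d
      have h2 := (h c).append [] (classCompl c (a :: w))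
      have h3 := h1.append (classPart c w') []
      simp only [List.nil_append, List.append_nil] at h2 h3
      exact (interchangeable_sort c _).trans (h2.trans (h3.trans (interchangeable_sort c _).symm))

/-- The minus sign in the coordinate `a₀ - z` turns the decreasing order `≺` into the usual order of
integers. -/
theorem zGt_sub {x y : ℤ} (a₀ : F) (h : x < y) : ZGt (a₀ - x) (a₀ - y) := by
  obtain ⟨n, rfl⟩ := Int.le.dest h.le
  exact ⟨n, by omega, by push_cast; ring⟩

theorem zGe_sub {x y : ℤ} (a₀ : F) (h : x ≤ y) : ZGe (a₀ - x) (a₀ - y) := by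
  obtain ⟨n, rfl⟩ := Int.le.dest h
  exact ⟨n, by push_cast; ring⟩

theorem KnuthStep.interchange {w w' : List ℤ} (a₀ : F) (h : KnuthStep w w') :
    Interchange (w.map fun z : ℤ => a₀ - z) (w'.map fun z : ℤ => a₀ - z) := by
  cases h with
  | @right u v x y z hxy hyz =>
    refine ⟨u.map fun z : ℤ => a₀ - z, (y :: v).map fun z : ℤ => a₀ - z, a₀ - x, a₀ - z,
      by simp, by simp, .inr (.inr (.inl ⟨a₀ - y, by simp, zGt_sub a₀ hxy, zGe_sub a₀ hyz⟩))⟩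
  | @left u v x y z hxy hyz =>
    refine ⟨(u ++ [y]).map fun z : ℤ => a₀ - z, v.map fun z : ℤ => a₀ - z, a₀ - x, a₀ - z,
      by simp, by simp,
      .inr (.inr (.inr (.inr ⟨a₀ - y, by simp, zGe_sub a₀ hxy, zGt_sub a₀ hyz⟩)))⟩

theorem KnuthEquiv.interchangeable {w w' : List ℤ} (a₀ : F) (h : KnuthEquiv w w') :
    Interchangeable (w.map fun z : ℤ => a₀ - z) (w'.map fun z : ℤ => a₀ - z) := by
  induction h with
  | rel _ _ h => exact .single (h.interchange a₀)
  | refl _ => exact .refl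
  | symm _ _ _ ih => exact ih.symm
  | trans _ _ _ _ _ ih ih' => exact ih.trans ih'

theorem exists_integral_coordinate (a₀ : F) :
    ∃ h : F → ℤ, ∀ a, intClass a = intClass a₀ → a₀ - h a = a := by
  choose! h hh using fun a (e : intClass a = intClass a₀) => intClass_eq_iff.1 e
  exact ⟨h, fun a e => by rw [← hh a e]; ring⟩

theorem ZGe.intClass_eq {a b : F} (h : ZGe a b) : intClass a = intClass b := by
  obtain ⟨n, e⟩ := h
  exact intClass_eq_iff.2 ⟨-n, by push_cast; linear_combination -e⟩

theorem perm_of_classPart_perm {w w' : List F}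
    (h : ∀ c, (classPart c w).Perm (classPart c w')) : w.Perm w' := by
  classical
  refine List.perm_iff_count.2 fun a => ?_
  have key : ∀ v : List F, (classPart (intClass a) v).count a = v.count a := fun v => by
    rw [classPart, List.count_filter (by simp)]
  rw [← key w, ← key w', (h _).count_eq]

variable [CharZero F]

theorem sub_intCast_injective (a₀ : F) : Function.Injective fun z : ℤ => a₀ - (z : F) :=
  fun x y h => by simpa using h

theorem zGt_sub_iff {x y : ℤ} (a₀ : F) : ZGt (a₀ - x) (a₀ - y) ↔ x < y := by
  refine ⟨fun ⟨n, hn, e⟩ => ?_, zGt_sub a₀⟩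
  have : ((y - x : ℤ) : F) = (n : ℤ) := by push_cast; linear_combination e
  have := Int.cast_injective this
  omega

theorem zGe_sub_iff {x y : ℤ} (a₀ : F) : ZGe (a₀ - x) (a₀ - y) ↔ x ≤ y := by
  refine ⟨fun ⟨n, e⟩ => ?_, zGe_sub a₀⟩
  have : ((y - x : ℤ) : F) = (n : ℤ) := by push_cast; linear_combination e
  have := Int.cast_injective this
  omega

theorem prec_sub_iff (a₀ : F) (p q : ℤ × ℕ) :
    Prec (a₀ - (p.1 : F), p.2) (a₀ - (q.1 : F), q.2) ↔ LexPrec p q := by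
  rw [Prec, LexPrec, zGt_sub_iff]
  simp

/-- In terms of an integral coordinate, the finite RS-algorithm in one integrality class is the
insertion algorithm for integers. -/
theorem finRS_eq_tableau {a₀ : F} {w : List F} {h : F → ℤ}
    (hh : ∀ a, intClass a = intClass a₀ → a₀ - h a = a) :
    finRS w (intClass a₀) =
      (tableau (· ≤ ·) ((classPart (intClass a₀) w).map h)).map
        (List.map fun z : ℤ => a₀ - z) := by
  set P := part w 1 (intClass a₀) with hP
  set Q := P.map fun p => (h p.1, p.2) with hQ
  have e : P = Q.map fun p : ℤ × ℕ => (a₀ - (p.1 : F), p.2) := by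
    rw [hQ, List.map_map]
    refine (List.map_id P).symm.trans (List.map_congr_left fun p hp => ?_)
    simp [hh _ (mem_part hp).2]
  have hQs : Standard Q := by
    rw [Standard, hQ, List.pairwise_map]
    refine (pairwise_snd_part w 1 (intClass a₀)).imp fun {p q} hpq => ?_
    exact fun _ => hpq
  have eQ : Q.map Prod.fst = (classPart (intClass a₀) w).map h := by
    rw [← map_fst_part_eq w 1, hQ, List.map_map, List.map_map]
    rfl
  rw [← eQ, ← tableau_lexPrec hQs, ← finRS_shift w 1, ← hP, e,
    tableau_map (lt := LexPrec) _ (prec_sub_iff a₀), List.map_map, List.map_map]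
  congr 1
  funext l
  simp

/-- Letters of other classes affect only the positions, which have been eliminated. -/
theorem finRS_eq_of_classPart_eq {w w' : List F} {c : IntClass F}
    (h : classPart c w = classPart c w') : finRS w c = finRS w' c := by
  obtain ⟨a₀, rfl⟩ := QuotientAddGroup.mk_surjective c
  obtain ⟨k, hk⟩ := exists_integral_coordinate a₀
  rw [finRS_eq_tableau hk, finRS_eq_tableau hk, h]

theorem classPart_interchangeable {w w' : List F} {c : IntClass F}
    (h : finRS w c = finRS w' c) : Interchangeable (classPart c w) (classPart c w') := by
  obtain ⟨a₀, rfl⟩ := QuotientAddGroup.mk_surjective c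
  obtain ⟨k, hk⟩ := exists_integral_coordinate a₀
  rw [finRS_eq_tableau hk, finRS_eq_tableau hk] at h
  have h' := List.map_injective_iff.2 (List.map_injective_iff.2 (sub_intCast_injective a₀)) h
  have key : ∀ v, (classPart (intClass a₀) v).map ((fun z : ℤ => a₀ - z) ∘ k) =
      classPart (intClass a₀) v := fun v =>
    (List.map_congr_left fun a ha => hk a (mem_classPart.1 ha).2).trans (List.map_id _)
  simpa only [List.map_map, key] using
    (knuthEquiv_of_tableau_eq h').interchangeable a₀

theorem interchangeable_of_finRS_eq {w w' : List F} (h : finRS w = finRS w') :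
    Interchangeable w w' :=
  interchangeable_of_classPart fun c => classPart_interchangeable (congrFun h c)

/-- An admissible interchange does not change the output of the finite RS-algorithm. -/
theorem Interchange.finRS_eq {w w' : List F} (h : Interchange w w') : finRS w = finRS w' := by
  obtain ⟨u, v, a, b, rfl, rfl, h⟩ := h
  funext c
  -- If both letters lie in `c`, so does a witness between them, and it stays adjacent in the class
  -- part: this is a Knuth step. Otherwise the class part keeps at most one of the two letters and
  -- does not change.
  by_cases hab : intClass a = c ∧ intClass b = c
  · obtain ⟨ha, hb⟩ := hab
    obtain ⟨k, hk⟩ := exists_integral_coordinate a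
    have hlt : ∀ {x y}, intClass x = c → intClass y = c → ZGt x y → k x < k y := by
      intro x y hx hy hxy
      rwa [← hk x (hx.trans ha.symm), ← hk y (hy.trans ha.symm), zGt_sub_iff] at hxy
    have hle : ∀ {x y}, intClass x = c → intClass y = c → ZGe x y → k x ≤ k y := by
      intro x y hx hy hxy
      rwa [← hk x (hx.trans ha.symm), ← hk y (hy.trans ha.symm), zGe_sub_iff] at hxy
    rw [← ha, finRS_eq_tableau hk, finRS_eq_tableau hk, ha]
    congr 1
    refine KnuthEquiv.tableau_eq ?_
    simp only [classPart_append, classPart_cons_of_eq ha, classPart_cons_of_eq hb]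
    rcases h with h | ⟨d, hd, h⟩ | ⟨d, hd, h⟩ | ⟨d, hd, h⟩ | ⟨d, hd, h⟩
    · exact absurd (intClass_eq_iff.1 (ha.trans hb.symm)) h
    · obtain ⟨v, rfl⟩ := List.head?_eq_some_iff.1 hd
      have hdc := h.2.intClass_eq.trans ha
      rw [classPart_cons_of_eq hdc]
      simpa using KnuthEquiv.symm
        (KnuthStep.knuthEquiv (.right _ _ (hlt hb hdc h.1) (hle hdc ha h.2)))
    · obtain ⟨v, rfl⟩ := List.head?_eq_some_iff.1 hd
      have hdc := h.2.intClass_eq.trans hb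
      rw [classPart_cons_of_eq hdc]
      simpa using KnuthStep.knuthEquiv
        (.right _ _ (hlt ha hdc h.1) (hle hdc hb h.2))
    · obtain ⟨u, rfl⟩ := List.getLast?_eq_some_iff.1 hd
      have hdc := h.2.intClass_eq.trans ha
      rw [classPart_append, classPart_cons_of_eq hdc, show classPart c [] = [] from rfl]
      simpa using KnuthEquiv.symm
        (KnuthStep.knuthEquiv (.left _ _ (hle hb hdc h.1) (hlt hdc ha h.2)))
    · obtain ⟨u, rfl⟩ := List.getLast?_eq_some_iff.1 hd
      have hdc := h.2.intClass_eq.trans hb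
      rw [classPart_append, classPart_cons_of_eq hdc, show classPart c [] = [] from rfl]
      simpa using KnuthStep.knuthEquiv
        (.left _ _ (hle ha hdc h.1) (hlt hdc hb h.2))
  · refine finRS_eq_of_classPart_eq ?_
    rw [classPart_append, classPart_append]
    congr 1
    by_cases ha : intClass a = c
    · have hb : intClass b ≠ c := fun hb => hab ⟨ha, hb⟩
      simp only [classPart_cons_of_eq ha, classPart_cons_of_ne hb]
    · simp only [classPart, List.filter_cons, ha, decide_false, Bool.false_eq_true, if_false]

end Words

/-! ### Interchanges of functions and of their finite segments -/

section Indices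

variable {F : Type*} [Field F] {ι : Type*} [LinearOrder ι]

theorem pairwise_lt_of_isChain_covBy {L : List ι} (hL : L.IsChain (· ⋖ ·)) :
    L.Pairwise (· < ·) :=
  List.isChain_iff_pairwise.1 (hL.imp fun _ _ h => h.lt)

/-- An interchange of letters in a finite segment of `f` is an admissible interchange of `f`. -/
theorem exists_admissibleAt {L : List ι} (hL : L.IsChain (· ⋖ ·)) {f : ι → F} {w : List F}
    (h : Interchange (L.map f) w) :
    ∃ g, (∃ i, AdmissibleAt i f g) ∧ L.map g = w ∧ ∀ k ∉ L, g k = f k := by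
  obtain ⟨u, v, a, b, e, rfl, h⟩ := h
  obtain ⟨U, V, rfl, rfl, eV⟩ := List.map_eq_append_iff.1 e
  obtain ⟨i, W, rfl, rfl, eW⟩ := List.map_eq_cons_iff.1 eV
  obtain ⟨j, V, rfl, rfl, rfl⟩ := List.map_eq_cons_iff.1 eW
  have hlt := pairwise_lt_of_isChain_covBy hL
  have hij : i ⋖ j := by
    have := (List.isChain_append.1 hL).2.1
    simp only [List.isChain_cons_cons] at this
    exact this.1
  have hU : ∀ k ∈ U, k ≠ i ∧ k ≠ j := fun k hk =>
    ⟨((List.pairwise_append.1 hlt).2.2 k hk i (by simp)).ne,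
      ((List.pairwise_append.1 hlt).2.2 k hk j (by simp)).ne⟩
  have hV : ∀ k ∈ V, k ≠ i ∧ k ≠ j := by
    have := (List.pairwise_append.1 hlt).2.1
    simp only [List.pairwise_cons, List.mem_cons] at this
    exact fun k hk => ⟨(this.1 k (.inr hk)).ne', (this.2.1 k hk).ne'⟩
  have hf : ∀ k, k ≠ i ∧ k ≠ j → f (Equiv.swap i j k) = f k := fun k hk => by
    rw [Equiv.swap_apply_of_ne_of_ne hk.1 hk.2]
  refine ⟨fun k => f (Equiv.swap i j k), ⟨i, j, hij, fun k h1 h2 => (hf k ⟨h1, h2⟩).symm,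
    by simp, by simp, ?_⟩, ?_, fun k hk => hf k ⟨?_, ?_⟩⟩
  · have hVh : ∀ c ∈ (V.map f).head?, ∃ k, j ⋖ k ∧ f k = c := by
      intro c hc
      cases V with
      | nil => simp at hc
      | cons k V =>
        have := (List.isChain_append.1 hL).2.1
        simp only [List.isChain_cons_cons] at this
        exact ⟨k, this.2.1, by simpa using hc⟩
    have hUl : ∀ c ∈ (U.map f).getLast?, ∃ k, k ⋖ i ∧ f k = c := by
      intro c hc
      rw [List.getLast?_map, Option.mem_def, Option.map_eq_some_iff] at hc
      obtain ⟨k, hk, rfl⟩ := hc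
      exact ⟨k, (List.isChain_append.1 hL).2.2 k hk i rfl, rfl⟩
    rcases h with h | ⟨c, hc, h⟩ | ⟨c, hc, h⟩ | ⟨c, hc, h⟩ | ⟨c, hc, h⟩
    · exact .inl h
    · obtain ⟨k, hk, rfl⟩ := hVh c hc
      exact .inr (.inl ⟨k, hk, h⟩)
    · obtain ⟨k, hk, rfl⟩ := hVh c hc
      exact .inr (.inr (.inl ⟨k, hk, h⟩))
    · obtain ⟨k, hk, rfl⟩ := hUl c hc
      exact .inr (.inr (.inr (.inl ⟨k, hk, h⟩)))
    · obtain ⟨k, hk, rfl⟩ := hUl c hc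
      exact .inr (.inr (.inr (.inr ⟨k, hk, h⟩)))
  · simp only [List.map_append, List.map_cons, Equiv.swap_apply_left, Equiv.swap_apply_right,
      List.map_congr_left fun k hk => hf k (hU k hk), List.map_congr_left fun k hk => hf k (hV k hk)]
  · rintro rfl
    simp at hk
  · rintro rfl
    simp at hk

theorem exists_connected {L : List ι} (hL : L.IsChain (· ⋖ ·)) {f : ι → F} {w : List F}
    (h : Interchangeable (L.map f) w) :
    ∃ g, Connected f g ∧ L.map g = w ∧ ∀ k ∉ L, g k = f k := by
  induction h with
  | refl => exact ⟨f, .refl, rfl, fun _ _ => rfl⟩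
  | tail _ h ih =>
    obtain ⟨g, hfg, rfl, hg⟩ := ih
    obtain ⟨g', hgg', e, hg'⟩ := exists_admissibleAt hL h
    exact ⟨g', hfg.tail hgg', e, fun k hk => (hg' k hk).trans (hg k hk)⟩

/-- Functions which agree outside of a finite segment are connected by admissible interchanges if
the outputs of the finite RS-algorithm for this segment agree. -/
theorem connected_of_finRS_eq [CharZero F] {L : List ι} (hL : L.IsChain (· ⋖ ·)) {f g : ι → F}
    (h : finRS (L.map f) = finRS (L.map g)) (hfg : ∀ k ∉ L, f k = g k) : Connected f g := by
  obtain ⟨g', hg', e, hk⟩ := exists_connected hL (interchangeable_of_finRS_eq h)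
  have : g' = g := by
    funext k
    by_cases hkL : k ∈ L
    · exact List.map_inj_left.1 e k hkL
    · rw [hk k hkL, hfg k hkL]
  exact this ▸ hg'

/-- An admissible interchange induces an interchange of the letters of every finite segment which
contains the two indices and all their neighbours. -/
theorem AdmissibleAt.interchange {i : ι} {f g : ι → F} (h : AdmissibleAt i f g) {L : List ι}
    (hL : L.IsChain (· ⋖ ·)) (hi : i ∈ L) (hn : ∀ j, i ⋖ j → j ∈ L)
    (hn2 : ∀ j k, i ⋖ j → j ⋖ k → k ∈ L) (hp : ∀ k, k ⋖ i → k ∈ L) :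
    Interchange (L.map f) (L.map g) := by
  obtain ⟨j, hij, hfg, hfi, hfj, h⟩ := h
  have hjL := hn j hij
  have hn2 := fun k => hn2 j k hij
  clear hn
  have hlt := pairwise_lt_of_isChain_covBy hL
  obtain ⟨U, W, rfl⟩ := List.append_of_mem hi
  have hU : ∀ k ∈ U, k < i := fun k hk => (List.pairwise_append.1 hlt).2.2 k hk i (by simp)
  have hjW : j ∈ W := by
    simp only [List.mem_append, List.mem_cons] at hjL
    rcases hjL with h | h | h
    · exact absurd (hU j h) hij.lt.asymm
    · exact absurd h hij.lt.ne'
    · exact h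
  cases W with
  | nil => simp at hjW
  | cons j' V =>
    have hch := (List.isChain_append.1 hL).2.1
    rw [List.isChain_cons_cons] at hch
    obtain rfl : j = j' := hij.unique_right hch.1
    have hV : ∀ k ∈ V, j < k := by
      have := (List.pairwise_append.1 hlt).2.1
      simp only [List.pairwise_cons] at this
      exact this.2.1
    have hVk : ∀ k, j ⋖ k → f k ∈ (V.map f).head? := by
      intro k hk
      have hkL := hn2 k hk
      simp only [List.mem_append, List.mem_cons] at hkL
      rcases hkL with h | h | h | h
      · exact absurd ((hU k h).trans hij.lt) hk.lt.asymm
      · exact absurd (h ▸ hij.lt) hk.lt.asymm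
      · exact absurd h hk.lt.ne'
      · cases V with
        | nil => simp at h
        | cons k' V =>
          have := hch.2
          rw [List.isChain_cons_cons] at this
          rw [hk.unique_right this.1]
          simp
    have hUk : ∀ k, k ⋖ i → f k ∈ (U.map f).getLast? := by
      intro k hk
      have hkL := hp k hk
      simp only [List.mem_append, List.mem_cons] at hkL
      rcases hkL with h | h | h | h
      · rcases List.eq_nil_or_concat U with rfl | ⟨U, k', rfl⟩
        · simp at h
        · have := (List.isChain_append.1 hL).2.2 k' (by simp) i rfl
          rw [hk.unique_left this]
          simp
      · exact absurd h hk.lt.ne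
      · exact absurd (h ▸ hij.lt) hk.lt.asymm
      · exact absurd (hij.lt.trans (hV k h)) hk.lt.asymm
    refine ⟨U.map f, V.map f, f i, f j, by simp, ?_, ?_⟩
    · rw [List.map_append, List.map_cons, List.map_cons, ← hfi, ← hfj]
      congr 1
      · exact List.map_congr_left fun k hk => (hfg k (hU k hk).ne ((hU k hk).trans hij.lt).ne).symm
      · congr 2
        exact List.map_congr_left fun k hk =>
          (hfg k (hij.lt.trans (hV k hk)).ne' (hV k hk).ne').symm
    · rcases h with h | ⟨k, hk, h⟩ | ⟨k, hk, h⟩ | ⟨k, hk, h⟩ | ⟨k, hk, h⟩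
      · exact .inl h
      · exact .inr (.inl ⟨_, hVk k hk, h⟩)
      · exact .inr (.inr (.inl ⟨_, hVk k hk, h⟩))
      · exact .inr (.inr (.inr (.inl ⟨_, hUk k hk, h⟩)))
      · exact .inr (.inr (.inr (.inr ⟨_, hUk k hk, h⟩)))

end Indices

/-! ### Recovering letters from the output -/

section Content

variable {F : Type*} [Field F]

/-- The tableaux contain each letter with its multiplicity. This later shows that the number `r` in
the definition of the output is the same for two functions with a common output. -/
theorem length_eq_of_finRS_eq {w w' : List F} (h : finRS w = finRS w') :
    w.length = w'.length :=
  (perm_of_classPart_perm fun c => (finRS_flatten_perm w c).symm.trans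
    (congrFun h c ▸ finRS_flatten_perm w' c)).length_eq

/-- If one letter is added to a word and the effect is that one entry is added to the first row,
then this entry is the letter. -/
theorem eq_of_withRow {ι : Type*} {T : Output F ι} {w w' x y : List F} {a b : F}
    (hw : w'.Perm (a :: w)) (hx : y.Perm (b :: x)) (h : finRS w = T.withRow x)
    (h' : finRS w' = T.withRow y) : b = a := by
  have e := finRS_flatten_perm w T.cls
  have e' := finRS_flatten_perm w' T.cls
  rw [h] at e
  rw [h'] at e'
  simp only [Output.withRow, if_true, List.flatten_cons] at e e'
  have h1 : (b :: classPart T.cls w).Perm (classPart T.cls w') :=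
    ((e.symm.cons b).trans (hx.symm.append_right _)).trans e'
  have h2 : (classPart T.cls w').Perm (classPart T.cls (a :: w)) := hw.filter _
  have h3 := h1.trans h2
  -- In the class of the infinite tableau the content has grown by `b`. If `a` lies there,
  -- cancellation gives the claim; otherwise the content could not have grown, and the lengths
  -- disagree.
  by_cases ha : intClass a = T.cls
  · rw [classPart_cons_of_eq ha, ← Multiset.coe_eq_coe, ← Multiset.cons_coe,
      ← Multiset.cons_coe, Multiset.cons_inj_left] at h3
    exact h3
  · rw [classPart_cons_of_ne ha] at h3
    have := h3.length_eq
    simp at this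

end Content

/-! ### Sequences on the negative integers -/

section Left

variable {F : Type*}

/-- The indices `-n, …, -1`. -/
def tailIndices (n : ℕ) : List (Set.Iio (0 : ℤ)) :=
  List.ofFn fun k : Fin n => ⟨(k : ℤ) - n, by have := k.2; simp only [Set.mem_Iio]; omega⟩

theorem map_tailIndices (f : Set.Iio (0 : ℤ) → F) (n : ℕ) : (tailIndices n).map f = tail f n := by
  simp only [tailIndices, tail, List.map_ofFn]
  rfl

theorem covBy_iff_Iio {i j : Set.Iio (0 : ℤ)} : i ⋖ j ↔ j.1 = i.1 + 1 := by
  constructor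
  · intro h
    by_contra hne
    have h1 : i.1 < j.1 := h.lt
    have hj : j.1 < 0 := j.2
    exact h.2 (c := ⟨i.1 + 1, show i.1 + 1 < 0 by omega⟩) (Subtype.mk_lt_mk.2 (by omega))
      (Subtype.mk_lt_mk.2 (by omega))
  · intro h
    refine ⟨Subtype.coe_lt_coe.1 (by omega), fun c h1 h2 => ?_⟩
    have h1 : i.1 < c.1 := h1
    have h2 : c.1 < j.1 := h2
    omega

theorem covBy_iff_Ioi {i j : Set.Ioi (0 : ℤ)} : i ⋖ j ↔ j.1 = i.1 + 1 := by
  constructor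
  · intro h
    by_contra hne
    have h1 : i.1 < j.1 := h.lt
    have hi : 0 < i.1 := i.2
    exact h.2 (c := ⟨i.1 + 1, show 0 < i.1 + 1 by omega⟩) (Subtype.mk_lt_mk.2 (by omega))
      (Subtype.mk_lt_mk.2 (by omega))
  · intro h
    refine ⟨Subtype.coe_lt_coe.1 (by omega), fun c h1 h2 => ?_⟩
    have h1 : i.1 < c.1 := h1
    have h2 : c.1 < j.1 := h2
    omega

theorem tailIndices_isChain (n : ℕ) : (tailIndices n).IsChain (· ⋖ ·) := by
  rw [List.isChain_iff_getElem]
  intro k hk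
  simp only [tailIndices, List.getElem_ofFn, covBy_iff_Iio]
  push_cast
  ring

theorem mem_tailIndices {n : ℕ} {i : Set.Iio (0 : ℤ)} : i ∈ tailIndices n ↔ -(n : ℤ) ≤ i.1 := by
  have hi : i.1 < 0 := i.2
  simp only [tailIndices, List.mem_ofFn, Subtype.ext_iff]
  constructor
  · rintro ⟨k, hk⟩
    omega
  · intro h
    exact ⟨⟨(i.1 + n).toNat, by omega⟩, by simp only; omega⟩

theorem tail_succ (f : Set.Iio (0 : ℤ) → F) (n : ℕ) :
    tail f (n + 1) = f ⟨-(n + 1 : ℕ), by simp only [Set.mem_Iio]; omega⟩ :: tail f n := by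
  rw [tail, List.ofFn_succ, tail]
  congr 1
  congr 1
  funext k
  congr 2
  simp

variable [Field F] [CharZero F]

/-- A single interchange takes place inside all large tails and leaves their finite outputs
unchanged, so the same `T` and `r` work. -/
theorem IsOutputLeft.of_connected {f g : Set.Iio (0 : ℤ) → F} (h : Connected f g)
    {T : Output F (Set.Iio (0 : ℤ))} (hf : IsOutputLeft f T) : IsOutputLeft g T := by
  induction h with
  | refl => exact hf
  | tail _ h ih =>
    obtain ⟨i, h⟩ := h
    obtain ⟨r, ih⟩ := ih
    refine ⟨r, ?_⟩
    -- The bound makes the tail reach down to `i - 1`, the lowest possible witness.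
    filter_upwards [ih, Filter.eventually_ge_atTop (-i.1 + 1).toNat] with n hn hni
    rw [← hn, ← map_tailIndices, ← map_tailIndices]
    refine (h.interchange (tailIndices_isChain _) ?_ ?_ ?_ ?_).finRS_eq.symm <;>
      simp only [covBy_iff_Iio, mem_tailIndices] <;> intros <;> omega

/-- The output determines the values far to the left, and on the remaining finite tail it determines
the finite RS output. -/
theorem connected_of_isOutputLeft {f g : Set.Iio (0 : ℤ) → F} {T : Output F (Set.Iio (0 : ℤ))}
    (hf : IsOutputLeft f T) (hg : IsOutputLeft g T) : Connected f g := by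
  obtain ⟨r, hf⟩ := hf
  obtain ⟨r', hg⟩ := hg
  obtain ⟨n, hn⟩ := Filter.eventually_atTop.1 (hf.and hg)
  have hr : r' = r := by
    have := length_eq_of_finRS_eq ((hn n le_rfl).1.trans (hn n le_rfl).2.symm)
    simp only [tail_length] at this
    omega
  subst hr
  -- Passing from `k` to `k + 1` adds one letter on the left of the tail and one entry on the left
  -- of the row; they must coincide. The shift by `r'` accounts for the entries outside the first
  -- row.
  have key : ∀ h : Set.Iio (0 : ℤ) → F,
      (∀ k ≥ n, finRS (tail h (k + r')) = T.withRow (tail T.firstRow k)) →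
      ∀ k, (hk : n ≤ k) → h ⟨-((k + r' : ℕ) + 1 : ℕ), by simp only [Set.mem_Iio]; omega⟩ =
        T.firstRow ⟨-((k + 1 : ℕ) : ℤ), by simp only [Set.mem_Iio]; omega⟩ := by
    intro h hh k hk
    refine (eq_of_withRow (w := tail h (k + r')) (w' := tail h (k + r' + 1)) ?_ ?_ (hh k hk)
      (by have := hh (k + 1) (by omega); rwa [Nat.add_right_comm] at this)).symm
    · rw [tail_succ]
    · rw [tail_succ]
  refine connected_of_finRS_eq (tailIndices_isChain (n + r')) ?_ fun k hk => ?_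
  · rw [map_tailIndices, map_tailIndices, (hn n le_rfl).1, (hn n le_rfl).2]
  · rw [mem_tailIndices] at hk
    obtain ⟨k, hk0⟩ := k
    obtain ⟨m, hm, rfl⟩ : ∃ m : ℕ, n ≤ m ∧ k = -((m + r' : ℕ) + 1 : ℕ) :=
      ⟨(-k - 1 - r').toNat, by simp only at hk; omega, by simp only at hk; omega⟩
    exact (key f (fun k hk => (hn k hk).1) m hm).trans (key g (fun k hk => (hn k hk).2) m hm).symm

theorem connected_iff_RSLeft_eq {f g : Set.Iio (0 : ℤ) → F} (hf : StablyDecreasing f)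
    (hg : StablyDecreasing g) : Connected f g ↔ RSLeft f hf = RSLeft g hg := by
  constructor
  · exact fun h => (isOutputLeft_iff hg).1 (.of_connected h ((isOutputLeft_iff hf).2 rfl))
  · exact fun h => connected_of_isOutputLeft ((isOutputLeft_iff hf).2 rfl)
      ((isOutputLeft_iff hg).2 h)

end Left

/-! ### Reflection of the positive integers -/

section Right

variable {F : Type*} [Field F]

theorem ZGe.neg {a b : F} (h : ZGe a b) : ZGe (-b) (-a) := by
  obtain ⟨n, e⟩ := h
  exact ⟨n, by linear_combination e⟩

/-- The inverse of `dual`. -/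
def undual (f : Set.Iio (0 : ℤ) → F) : Set.Ioi (0 : ℤ) → F :=
  fun i => - f ⟨-i.1, by have := i.2; simp only [Set.mem_Iio, Set.mem_Ioi] at *; omega⟩

theorem undual_dual (f : Set.Ioi (0 : ℤ) → F) : undual (dual f) = f := by
  funext i
  simp [undual, dual]

/-- Reversing the indices turns a right neighbour into a left one, and negation reverses `>_ℤ` and
`≥_ℤ`. So the two conditions with a witness on the right and the two with a witness on the left
change places, including which inequality is strict. -/
theorem AdmissibleAt.dual {i : Set.Ioi (0 : ℤ)} {f g : Set.Ioi (0 : ℤ) → F}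
    (h : AdmissibleAt i f g) : ∃ j, AdmissibleAt j (dual f) (dual g) := by
  obtain ⟨j, hij, hfg, hfi, hfj, h⟩ := h
  rw [covBy_iff_Ioi] at hij
  have hi0 : 0 < i.1 := i.2
  have hj0 : 0 < j.1 := j.2
  have e : ∀ (f : Set.Ioi (0 : ℤ) → F) (k : Set.Ioi (0 : ℤ)) (hk : -k.1 < 0),
      InfRS.dual f ⟨-k.1, hk⟩ = - f k := fun f k hk => by simp [InfRS.dual]
  have hneg : ∀ k : Set.Ioi (0 : ℤ), -k.1 < 0 := fun k => by
    have : 0 < k.1 := k.2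
    omega
  refine ⟨⟨-j.1, hneg j⟩, ⟨-i.1, hneg i⟩, covBy_iff_Iio.2 (by simp only; omega),
    fun k h1 h2 => ?_, by rw [e, e, hfj], by rw [e, e, hfi], ?_⟩
  · have hk : 0 < -k.1 := by have : k.1 < 0 := k.2; omega
    have := hfg ⟨-k.1, hk⟩ (fun h => h2 (Subtype.ext (by rw [← h]; simp)))
      (fun h => h1 (Subtype.ext (by rw [← h]; simp)))
    exact congrArg Neg.neg this
  · simp only [e]
    rcases h with h | ⟨k, hk, h, h'⟩ | ⟨k, hk, h, h'⟩ | ⟨k, hk, h, h'⟩ | ⟨k, hk, h, h'⟩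
    · exact .inl fun ⟨z, hz⟩ => h ⟨z, by linear_combination hz⟩
    all_goals rw [covBy_iff_Ioi] at hk
    · exact .inr (.inr (.inr (.inl ⟨⟨-k.1, hneg k⟩, covBy_iff_Iio.2 (by simp only; omega),
        by rw [e]; exact h'.neg, by rw [e]; exact h.neg⟩)))
    · exact .inr (.inr (.inr (.inr ⟨⟨-k.1, hneg k⟩, covBy_iff_Iio.2 (by simp only; omega),
        by rw [e]; exact h'.neg, by rw [e]; exact h.neg⟩)))
    · exact .inr (.inl ⟨⟨-k.1, hneg k⟩, covBy_iff_Iio.2 (by simp only; omega),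
        by rw [e]; exact h'.neg, by rw [e]; exact h.neg⟩)
    · exact .inr (.inr (.inl ⟨⟨-k.1, hneg k⟩, covBy_iff_Iio.2 (by simp only; omega),
        by rw [e]; exact h'.neg, by rw [e]; exact h.neg⟩))

theorem AdmissibleAt.undual {i : Set.Iio (0 : ℤ)} {f g : Set.Iio (0 : ℤ) → F}
    (h : AdmissibleAt i f g) : ∃ j, AdmissibleAt j (undual f) (undual g) := by
  obtain ⟨j, hij, hfg, hfi, hfj, h⟩ := h
  rw [covBy_iff_Iio] at hij
  have hi0 : i.1 < 0 := i.2
  have hj0 : j.1 < 0 := j.2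
  have e : ∀ (f : Set.Iio (0 : ℤ) → F) (k : Set.Iio (0 : ℤ)) (hk : 0 < -k.1),
      InfRS.undual f ⟨-k.1, hk⟩ = - f k := fun f k hk => by simp [InfRS.undual]
  have hneg : ∀ k : Set.Iio (0 : ℤ), 0 < -k.1 := fun k => by
    have : k.1 < 0 := k.2
    omega
  refine ⟨⟨-j.1, hneg j⟩, ⟨-i.1, hneg i⟩, covBy_iff_Ioi.2 (by simp only; omega),
    fun k h1 h2 => ?_, by rw [e, e, hfj], by rw [e, e, hfi], ?_⟩
  · have hk : -k.1 < 0 := by have : 0 < k.1 := k.2; omega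
    have := hfg ⟨-k.1, hk⟩ (fun h => h2 (Subtype.ext (by rw [← h]; simp)))
      (fun h => h1 (Subtype.ext (by rw [← h]; simp)))
    exact congrArg Neg.neg this
  · simp only [e]
    rcases h with h | ⟨k, hk, h, h'⟩ | ⟨k, hk, h, h'⟩ | ⟨k, hk, h, h'⟩ | ⟨k, hk, h, h'⟩
    · exact .inl fun ⟨z, hz⟩ => h ⟨z, by linear_combination hz⟩
    all_goals rw [covBy_iff_Iio] at hk
    · exact .inr (.inr (.inr (.inl ⟨⟨-k.1, hneg k⟩, covBy_iff_Ioi.2 (by simp only; omega),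
        by rw [e]; exact h'.neg, by rw [e]; exact h.neg⟩)))
    · exact .inr (.inr (.inr (.inr ⟨⟨-k.1, hneg k⟩, covBy_iff_Ioi.2 (by simp only; omega),
        by rw [e]; exact h'.neg, by rw [e]; exact h.neg⟩)))
    · exact .inr (.inl ⟨⟨-k.1, hneg k⟩, covBy_iff_Ioi.2 (by simp only; omega),
        by rw [e]; exact h'.neg, by rw [e]; exact h.neg⟩)
    · exact .inr (.inr (.inl ⟨⟨-k.1, hneg k⟩, covBy_iff_Ioi.2 (by simp only; omega),
        by rw [e]; exact h'.neg, by rw [e]; exact h.neg⟩))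

theorem connected_dual_iff {f g : Set.Ioi (0 : ℤ) → F} :
    Connected (dual f) (dual g) ↔ Connected f g := by
  constructor
  · intro h
    have : Connected (undual (dual f)) (undual (dual g)) :=
      Relation.ReflTransGen.lift undual (fun _ _ hs => hs.elim fun _ h => h.undual) _ _ h
    rwa [undual_dual, undual_dual] at this
  · exact fun h => Relation.ReflTransGen.lift dual (fun _ _ hs => hs.elim fun _ h => h.dual) _ _ h

end Right

/-! ### Sequences on all integers -/

section Two

variable {F : Type*}

/-- The indices `m, …, n`. -/
def windowIndices (m n : ℤ) : List ℤ := (List.range (n + 1 - m).toNat).map fun k : ℕ => m + k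

theorem map_windowIndices (f : ℤ → F) (m n : ℤ) : (windowIndices m n).map f = window f m n := by
  rw [windowIndices, window, List.map_map]
  rfl

theorem windowIndices_isChain (m n : ℤ) : (windowIndices m n).IsChain (· ⋖ ·) := by
  rw [List.isChain_iff_getElem]
  intro k hk
  simp only [windowIndices, List.getElem_map, List.getElem_range, Order.covBy_iff_add_one_eq]
  push_cast
  ring

theorem mem_windowIndices {m n i : ℤ} : i ∈ windowIndices m n ↔ m ≤ i ∧ i ≤ n := by
  simp only [windowIndices, List.mem_map, List.mem_range]
  constructor
  · rintro ⟨k, hk, rfl⟩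
    omega
  · rintro ⟨h1, h2⟩
    exact ⟨(i - m).toNat, by omega, by omega⟩

variable [Field F]

theorem window_succ (f : ℤ → F) {m n : ℤ} (h : m ≤ n + 1) :
    window f m (n + 1) = window f m n ++ [f (n + 1)] := by
  rw [window_append f (k := n + 1) h (by omega), add_sub_cancel_right]
  simp [window]

variable [CharZero F]

theorem IsOutputTwo.of_connected {f g : ℤ → F} (h : Connected f g) {T : Output F ℤ}
    (hf : IsOutputTwo f T) : IsOutputTwo g T := by
  induction h with
  | refl => exact hf
  | @tail b c _ h ih =>
    obtain ⟨i, h⟩ := h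
    obtain ⟨ih0, r, ih⟩ := ih
    refine ⟨?_, r, ?_⟩
    -- The normalisation of the first row survives because the values to the left of `i` do not
    -- change.
    · obtain ⟨j, hij, hbc, -⟩ := h
      rw [Order.covBy_iff_add_one_eq] at hij
      filter_upwards [ih0, Filter.eventually_lt_atBot i] with k hk hki
      rw [hk, hbc k (by omega) (by omega)]
    · filter_upwards [ih, (Filter.eventually_lt_atBot i).prod_mk
        (Filter.eventually_gt_atTop (i + 1))] with p hp hpi
      rw [← hp, ← map_windowIndices, ← map_windowIndices]
      refine (h.interchange (windowIndices_isChain _ _) ?_ ?_ ?_ ?_).finRS_eq.symm <;>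
        simp only [Order.covBy_iff_add_one_eq, mem_windowIndices] <;> intros <;> omega

/-- On the left the indexing of the first row identifies the values directly; on the right they are
recovered by enlarging the window, with the shift by `r`. -/
theorem connected_of_isOutputTwo {f g : ℤ → F} {T : Output F ℤ}
    (hf : IsOutputTwo f T) (hg : IsOutputTwo g T) : Connected f g := by
  obtain ⟨hf0, r, hf⟩ := hf
  obtain ⟨hg0, r', hg⟩ := hg
  obtain ⟨p, hp, q, hq, hpq⟩ := Filter.eventually_prod_iff.1 (hf.and hg)
  obtain ⟨m, hm⟩ := Filter.eventually_atBot.1 (hp.and (hf0.and hg0))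
  -- The left end `m` is fixed from now on, and all right ends from `n` on are allowed. The
  -- condition `m ≤ n` keeps the window lengths from being truncated when they are compared.
  obtain ⟨n, hmn, hn⟩ := ((Filter.eventually_ge_atTop m).and
    (Filter.eventually_atTop.2 ((Filter.eventually_atTop.1 hq).imp fun a ha b hb c hc =>
      ha c (hb.trans hc)) : ∀ᶠ n in Filter.atTop, ∀ c ≥ n, q c)).exists
  have H := fun k (hk : n ≤ k) => hpq (hm m le_rfl).1 (hn k hk)
  have hr : r' = r := by
    have := length_eq_of_finRS_eq ((H n le_rfl).1.trans (H n le_rfl).2.symm)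
    simp only [window_length] at this
    omega
  subst hr
  have key : ∀ h : ℤ → F,
      (∀ k ≥ n, finRS (window h m (k + r')) = T.withRow (window T.firstRow m k)) →
      ∀ k ≥ n, h (k + r' + 1) = T.firstRow (k + 1) := by
    intro h hh k hk
    refine (eq_of_withRow (w := window h m (k + r')) (w' := window h m (k + r' + 1)) ?_ ?_
      (hh k hk) (by have := hh (k + 1) (by omega); rwa [add_right_comm] at this)).symm
    · rw [window_succ _ (by omega)]
      exact List.perm_append_singleton _ _
    · rw [window_succ _ (by omega)]
      exact List.perm_append_singleton _ _
  refine connected_of_finRS_eq (windowIndices_isChain m (n + r')) ?_ fun k hk => ?_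
  · rw [map_windowIndices, map_windowIndices, (H n le_rfl).1, (H n le_rfl).2]
  · rw [mem_windowIndices] at hk
    rcases le_or_gt m k with h | h
    · have h1 := key f (fun k hk => (H k hk).1) (k - 1 - r') (by omega)
      have h2 := key g (fun k hk => (H k hk).2) (k - 1 - r') (by omega)
      rw [← h2] at h1
      simpa using h1
    · rw [← (hm k h.le).2.1, ← (hm k h.le).2.2]

end Two

end InfRS

theorem mainTheorem5 {F : Type*} [Field F] [IsAlgClosed F] [CharZero F] :
    (∀ (f f' : Set.Ioi (0 : ℤ) → F) (hf : InfRS.StablyDecreasing f)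
      (hf' : InfRS.StablyDecreasing f'),
      InfRS.Connected f f' ↔ InfRS.RSRight f hf = InfRS.RSRight f' hf') ∧
    (∀ (f f' : Set.Iio (0 : ℤ) → F) (hf : InfRS.StablyDecreasing f)
      (hf' : InfRS.StablyDecreasing f'),
      InfRS.Connected f f' ↔ InfRS.RSLeft f hf = InfRS.RSLeft f' hf') ∧
    (∀ (f f' : ℤ → F) (hf : InfRS.StablyDecreasing f) (hf' : InfRS.StablyDecreasing f')
      (ha : InfRS.AlmostIntegral f) (ha' : InfRS.AlmostIntegral f'),
      InfRS.Connected f f' ↔ InfRS.RSTwo f hf ha = InfRS.RSTwo f' hf' ha') := by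
  refine ⟨fun f f' hf hf' => ?_, fun f f' hf hf' => InfRS.connected_iff_RSLeft_eq hf hf',
    fun f f' hf hf' ha ha' => ⟨fun h => ?_, fun h => ?_⟩⟩
  -- By definition, `RSRight` is `RSLeft` applied to the dual sequence.
  · rw [← InfRS.connected_dual_iff]
    exact InfRS.connected_iff_RSLeft_eq _ _
  · exact (InfRS.isOutputTwo_iff hf' ha').1
      (.of_connected h ((InfRS.isOutputTwo_iff hf ha).2 rfl))
  · exact InfRS.connected_of_isOutputTwo ((InfRS.isOutputTwo_iff hf ha).2 rfl)
      ((InfRS.isOutputTwo_iff hf' ha').2 h)
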